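/- Let $k$ be a field of characteristic zero, $q\in k\setminus\{0,1\}$, and let $a=\sum_{i=0}^N\alpha_ih^i\in k[h]$ be monic of degree $N>1$. Let $A=A(a,q)$ be the $k$-algebra generated by $y,h,x$ subject to $$xh=qhx,\quad yx=a(h),\quad hy=qyh,\quad xy=a(qh).$$ Put $l(h)=a(qh)-a(h)=\sum_i\lambda_ih^i$, so $\lambda_i=(q^i-1)\alpha_i$, let $B=B_l$ be the Smith algebra generated by $Y,H,X$ subject to $HY=qYH$, $XY-YX=l(H)$, $XH=qHX$, and let $\Omega=YX-a(H)\in B$. Then $\Omega$ is central in $B$, and there is a surjective algebra map $B\to A$ with $Y\mapsto y$, $H\mapsto h$, $X\mapsto x$ and kernel $B\Omega$, so that $A\cong B/B\Omega$. Let $V=kY\oplus kH\oplus kX$ and let $A^e=A\otimes A^{\mathrm{op}}$ act on $A\otimes W\otimes A$ from the outside, for any vector space $W$; write $u|w|v$ for $u\otimes w\otimes v$, and $\int_i f(s,t)=\sum_{s,t\ge0,\ s+t+1=i}f(s,t)$. For $p\ge q'\ge0$ let $X_{p,q'}=A\otimes\Lambda^{p-q'}V\otimes A$, and let $X_{p,q'}=0$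 otherwise. Let $d:X_{p,q'}\to X_{p-1,q'}$ and $\delta:X_{p,q'}\to X_{p,q'-1}$ be the $A^e$-linear maps determined, whenever the target row and column are present, by \begin{align*} d(1|Y|1)&=1|y-y|1,\quad d(1|H|1)=1|h-h|1,\quad d(1|X|1)=1|x-x|1,\\ d(1|H\wedge X|1)&=1|X|h-qh|X|1-q|H|x+x|H|1,\\ d(1|Y\wedge X|1)&=1|X|y-y|X|1-1|Y|x+x|Y|1-\textstyle\sum_i\int_i\lambda_ih^s|H|h^t,\\ d(1|Y\wedge H|1)&=1|H|y-qy|H|1-q|Y|h+h|Y|1,\\ d(1|Y\wedge H\wedge X|1)&=1|H\wedge X|y-qy|H\wedge X|1-q|Y\wedge X|h+qh|Y\wedge X|1+q|Y\wedge H|x-x|Y\wedge H|1,\\ \delta(1|1)&=y|X|1+1|Y|x-\textstyle\sum_i\int_i\alpha_ih^s|H|h^t,\\ \delta(1|Y|1)&=-y|Y\wedge X|1+\textstyle\sum_i\int_i\alpha_iq^th^s|Y\wedge H|h^t,\\ \delta(1|H|1)&=1|Y\wedge H|x-y|H\wedge X|1,\\ \delta(1|X|1)&=1|Y\wedge X|x-\textstyle\sum_i\int_i\alpha_iq^sh^s|H\wedge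 X|h^t,\\ \delta(1|Y\wedge H|1)&=y|Y\wedge H\wedge X|1,\\ \delta(1|Y\wedge X|1)&=\textstyle\sum_i\int_i\alpha_iq^{i-1}h^s|Y\wedge H\wedge X|h^t,\\ \delta(1|H\wedge X|1)&=1|Y\wedge H\wedge X|x, \end{align*} and by $d=0$ on $X_{p,p}$, and $\delta=0$ on the row $q'=0$ and on $A\otimes\Lambda^3V\otimes A$. Then $d^2=0$, $\delta^2=0$ and $d\delta+\delta d=0$, and the total complex $\operatorname{Tot}X$, with $\operatorname{Tot}_n=\bigoplus_{p+q'=n}X_{p,q'}$, differential $d+\delta$ and augmentation the multiplication map $\mu:\operatorname{Tot}_0=A\otimes A\to A$, is a free resolution of $A$ as an $A^e$-module: each $\operatorname{Tot}_n$ is a free $A^e$-module and $$\cdots\to\operatorname{Tot}_2\to\operatorname{Tot}_1\to\operatorname{Tot}_0\xrightarrow{\ \mu\ }A\to0$$ is exact. -/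

import Mathlib

open scoped TensorProduct Polynomial

noncomputable section

namespace QuantumGWA

universe u

/-! ### The algebras -/

section Algebras

variable {k : Type u} [Field k]

/-- The free algebra on three letters; the letters `0`, `1`, `2` play the roles of
`y`, `h`, `x` (respectively `Y`, `H`, `X`). -/
abbrev Free3 (k : Type u) [Field k] : Type u := FreeAlgebra k (Fin 3)

/-- The defining relations of the generalized Weyl algebra `A(a, q)`:
`xh = qhx`, `yx = a(h)`, `hy = qyh`, `xy = a(qh)`. -/
inductive GWARel (q : k) (a : k[X]) : Free3 k → Free3 k → Prop
  | xh : GWARel q a (FreeAlgebra.ι k 2 * FreeAlgebra.ι k 1)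
      (q • (FreeAlgebra.ι k 1 * FreeAlgebra.ι k 2))
  | yx : GWARel q a (FreeAlgebra.ι k 0 * FreeAlgebra.ι k 2)
      (Polynomial.aeval (FreeAlgebra.ι k 1) a)
  | hy : GWARel q a (FreeAlgebra.ι k 1 * FreeAlgebra.ι k 0)
      (q • (FreeAlgebra.ι k 0 * FreeAlgebra.ι k 1))
  | xy : GWARel q a (FreeAlgebra.ι k 2 * FreeAlgebra.ι k 0)
      (Polynomial.aeval (q • FreeAlgebra.ι k 1) a)

/-- The generalized Weyl algebra `A = A(a, q)` (the quantum case). -/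
def GWA (q : k) (a : k[X]) : Type u := RingQuot (GWARel q a)

instance (q : k) (a : k[X]) : Ring (GWA q a) := inferInstanceAs (Ring (RingQuot (GWARel q a)))

instance (q : k) (a : k[X]) : Algebra k (GWA q a) :=
  inferInstanceAs (Algebra k (RingQuot (GWARel q a)))

/-- The generators `y = gen 0`, `h = gen 1`, `x = gen 2` of `A(a, q)`. -/
def GWA.gen (q : k) (a : k[X]) (i : Fin 3) : GWA q a :=
  RingQuot.mkAlgHom k (GWARel q a) (FreeAlgebra.ι k i)

/-- The defining relations of the Smith algebra `B_l`:
`HY = qYH`, `XY - YX = l(H)`, `XH = qHX`. -/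
inductive SmithRel (q : k) (l : k[X]) : Free3 k → Free3 k → Prop
  | hy : SmithRel q l (FreeAlgebra.ι k 1 * FreeAlgebra.ι k 0)
      (q • (FreeAlgebra.ι k 0 * FreeAlgebra.ι k 1))
  | xy : SmithRel q l
      (FreeAlgebra.ι k 2 * FreeAlgebra.ι k 0 - FreeAlgebra.ι k 0 * FreeAlgebra.ι k 2)
      (Polynomial.aeval (FreeAlgebra.ι k 1) l)
  | xh : SmithRel q l (FreeAlgebra.ι k 2 * FreeAlgebra.ι k 1)
      (q • (FreeAlgebra.ι k 1 * FreeAlgebra.ι k 2))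

/-- The Smith algebra `B_l`. -/
def Smith (q : k) (l : k[X]) : Type u := RingQuot (SmithRel q l)

instance (q : k) (l : k[X]) : Ring (Smith q l) := inferInstanceAs (Ring (RingQuot (SmithRel q l)))

instance (q : k) (l : k[X]) : Algebra k (Smith q l) :=
  inferInstanceAs (Algebra k (RingQuot (SmithRel q l)))

/-- The generators `Y = gen 0`, `H = gen 1`, `X = gen 2` of `B_l`. -/
def Smith.gen (q : k) (l : k[X]) (i : Fin 3) : Smith q l :=
  RingQuot.mkAlgHom k (SmithRel q l) (FreeAlgebra.ι k i)

/-- The polynomial `l = σ(a) - a`, where `σ(h) = qh`; its coefficients are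
`λ_i = (q ^ i - 1) α_i`. -/
def smithPoly (q : k) (a : k[X]) : k[X] :=
  a.comp (Polynomial.C q * Polynomial.X) - a

/-- The element `Ω = YX - a(H)` of the Smith algebra `B_l`, `l = σ(a) - a`. -/
def Omega (q : k) (a : k[X]) : Smith q (smithPoly q a) :=
  Smith.gen q (smithPoly q a) 0 * Smith.gen q (smithPoly q a) 2
    - Polynomial.aeval (Smith.gen q (smithPoly q a) 1) a

end Algebras

/-! ### Bimodules `A|W|A = A ⊗ W ⊗ A` -/

section Bimodules

variable (k : Type u) [Field k] (A : Type u) [Ring A] [Algebra k A]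

/-- The enveloping algebra `A^e = A ⊗ A^op`. -/
abbrev Env : Type u := A ⊗[k] Aᵐᵒᵖ

variable (W : Type u) [AddCommGroup W] [Module k W]

/-- The bimodule `A|W|A`, that is `A ⊗ W ⊗ A`. -/
def Tri : Type u := A ⊗[k] (W ⊗[k] A)

instance : AddCommGroup (Tri k A W) := inferInstanceAs (AddCommGroup (A ⊗[k] (W ⊗[k] A)))

instance : Module k (Tri k A W) := inferInstanceAs (Module k (A ⊗[k] (W ⊗[k] A)))

variable {k A W}

/-- The element `u|w|v`. -/
def tri (u : A) (w : W) (v : A) : Tri k A W := u ⊗ₜ[k] (w ⊗ₜ[k] v)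

variable (k A W)

/-- The rearrangement `A ⊗ W ⊗ A ≃ A^e ⊗ W`, `u|w|v ↦ (u ⊗ v°) ⊗ w`. -/
def triEquiv : Tri k A W ≃ₗ[k] Env k A ⊗[k] W :=
  (TensorProduct.congr (LinearEquiv.refl k A)
    ((TensorProduct.comm k W A).trans
      (TensorProduct.congr (MulOpposite.opLinearEquiv k) (LinearEquiv.refl k W)))).trans
    (TensorProduct.assoc k A Aᵐᵒᵖ W).symm

/-- The outer bimodule structure of `A ⊗ W ⊗ A`: `(u ⊗ v°) • (r|w|s) = ur|w|sv`, see
`env_smul_tri`. -/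
instance triModule : Module (Env k A) (Tri k A W) := (triEquiv k A W).toAddEquiv.module (Env k A)

instance triTower : IsScalarTower k (Env k A) (Tri k A W) :=
  (triEquiv k A W).isScalarTower (Env k A)

variable {k A W}

theorem triEquiv_tri (u v : A) (w : W) :
    triEquiv k A W (tri u w v) = (u ⊗ₜ[k] MulOpposite.op v) ⊗ₜ[k] w := rfl

theorem triEquiv_smul (e : Env k A) (t : Tri k A W) :
    triEquiv k A W (e • t) = e • triEquiv k A W t :=
  (triEquiv k A W).apply_symm_apply _

theorem env_smul_tri (u v r s : A) (w : W) :
    (u ⊗ₜ[k] MulOpposite.op v : Env k A) • (tri r w s : Tri k A W) = tri (u * r) w (s * v) := by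
  apply (triEquiv k A W).injective
  rw [triEquiv_smul, triEquiv_tri, triEquiv_tri, TensorProduct.smul_tmul', smul_eq_mul,
    Algebra.TensorProduct.tmul_mul_tmul, MulOpposite.op_mul]

/-- For a `k`-linear map `f : W → M` to an `A^e`-module, the unique `A^e`-linear map
`A|W|A → M` sending `1|w|1` to `f w`. -/
def ofGen {M : Type u} [AddCommGroup M] [Module k M] [Module (Env k A) M]
    [IsScalarTower k (Env k A) M] (f : W →ₗ[k] M) : Tri k A W →ₗ[Env k A] M :=
  TensorProduct.AlgebraTensorModule.lift
      (LinearMap.toSpanSingleton (Env k A) (W →ₗ[k] M) f) ∘ₗ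
    { toFun := triEquiv k A W
      map_add' := map_add _
      map_smul' := triEquiv_smul }

theorem ofGen_tri {M : Type u} [AddCommGroup M] [Module k M] [Module (Env k A) M]
    [IsScalarTower k (Env k A) M] (f : W →ₗ[k] M) (u v : A) (w : W) :
    ofGen f (tri u w v : Tri k A W) = (u ⊗ₜ[k] MulOpposite.op v : Env k A) • f w := rfl

end Bimodules

/-! ### The exterior powers of `V = kY ⊕ kH ⊕ kX` -/

section Exterior

variable (k : Type u) [Field k]

/-- The vector space `V` with basis `Y`, `H`, `X` (the indices `0`, `1`, `2`). -/
abbrev V : Type u := Fin 3 → k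

variable {k} {j : ℕ}

/-- `v_0 ∧ ⋯ ∧ v_{j-1}` for a word `v` in the basis `Y`, `H`, `X`. -/
def wedge (v : Fin j → Fin 3) : ⋀[k]^j (V k) :=
  exteriorPower.ιMulti k j fun i => Pi.single (v i) 1

/-- The coordinate of an element of `⋀^j V` along `v_0 ∧ ⋯ ∧ v_{j-1}`, where `v` is a strictly
increasing word. -/
def coord (v : Fin j → Fin 3) : ⋀[k]^j (V k) →ₗ[k] k :=
  exteriorPower.pairingDual k (V k) j
    (exteriorPower.ιMulti k j fun i => (LinearMap.proj (v i) : V k →ₗ[k] k))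

theorem coord_wedge (v w : Fin j → Fin 3) :
    coord v (wedge w : ⋀[k]^j (V k))
      = (Matrix.of fun r c => if v c = w r then (1 : k) else 0).det := by
  rw [coord, wedge, exteriorPower.pairingDual_ιMulti_ιMulti]
  congr 1
  ext r c
  simp [Pi.single_apply]

end Exterior

/-! ### The double complex and its total complex -/

section Complex

variable {k : Type u} [Field k] (q : k) (a : k[X])

/-- `A` as an `A^e`-module: `(u ⊗ v°) • z = uzv`. -/
instance gwaEnvModule : Module (Env k (GWA q a)) (GWA q a) := TensorProduct.Algebra.module

instance gwaEnvTower : IsScalarTower k (Env k (GWA q a)) (GWA q a) where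
  smul_assoc c e t := by
    change TensorProduct.Algebra.moduleAux _ _ = _ • TensorProduct.Algebra.moduleAux _ _
    simp

/-- The bimodule `A|⋀^j V|A`. In the double complex it is the entry `X_{p,q}` in every bidegree
`(p, q)` with `q ≥ 0` and `p - q = j`. -/
abbrev Term (j : ℕ) : Type u := Tri k (GWA q a) (⋀[k]^j (V k))

/-- The sum of `f s t` over all `s, t ≥ 0` with `s + t + 1 = i`. -/
def tint {M : Type u} [AddCommMonoid M] (i : ℕ) (f : ℕ → ℕ → M) : M :=
  ∑ s ∈ Finset.range i, f s (i - 1 - s)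

/-- The element `u | v_0 ∧ ⋯ ∧ v_{j-1} | v` of `A|⋀^j V|A`. -/
def el {j : ℕ} (u : GWA q a) (w : Fin j → Fin 3) (v : GWA q a) : Term q a j := tri u (wedge w) v

/-- The `A^e`-linear map `A|⋀^i V|A → A|⋀^j V|A` with prescribed value `m` on
`1 | v_0 ∧ ⋯ ∧ v_{i-1} | 1`, and zero on the other standard generators. Here `v` is a strictly
increasing word. -/
def single {i j : ℕ} (v : Fin i → Fin 3) (m : Term q a j) :
    Term q a i →ₗ[Env k (GWA q a)] Term q a j :=
  ofGen ((coord v).smulRight m)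

local notation "y" => GWA.gen q a 0
local notation "h" => GWA.gen q a 1
local notation "x" => GWA.gen q a 2

/-- The horizontal differentials `d : A|⋀^{j+1} V|A → A|⋀^j V|A`, of bidegree `(-1, 0)`;
each `single v m` says that `d(1|v|1) = m`. -/
def dHor : (j : ℕ) → (Term q a (j + 1) →ₗ[Env k (GWA q a)] Term q a j)
  | 0 =>
    single q a ![0] (el q a 1 ![] y - el q a y ![] 1) +
    single q a ![1] (el q a 1 ![] h - el q a h ![] 1) +
    single q a ![2] (el q a 1 ![] x - el q a x ![] 1)
  | 1 =>
    single q a ![1, 2]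
      (el q a 1 ![2] h - q • el q a h ![2] 1 - q • el q a 1 ![1] x + el q a x ![1] 1) +
    single q a ![0, 2]
      (el q a 1 ![2] y - el q a y ![2] 1 - el q a 1 ![0] x + el q a x ![0] 1
        - ∑ i ∈ Finset.range (a.natDegree + 1), tint i fun s t =>
            (smithPoly q a).coeff i • el q a (h ^ s) ![1] (h ^ t)) +
    single q a ![0, 1]
      (el q a 1 ![1] y - q • el q a y ![1] 1 - q • el q a 1 ![0] h + el q a h ![0] 1)
  | 2 =>
    single q a ![0, 1, 2]
      (el q a 1 ![1, 2] y - q • el q a y ![1, 2] 1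
        - q • el q a 1 ![0, 2] h + q • el q a h ![0, 2] 1
        + q • el q a 1 ![0, 1] x - el q a x ![0, 1] 1)
  | _ + 3 => 0

/-- The vertical differentials `δ : A|⋀^j V|A → A|⋀^{j+1} V|A`, which lower `q` by one and
keep `p`; each `single v m` says that `δ(1|v|1) = m`. -/
def dVert : (j : ℕ) → (Term q a j →ₗ[Env k (GWA q a)] Term q a (j + 1))
  | 0 =>
    single q a ![]
      (el q a y ![2] 1 + el q a 1 ![0] x
        - ∑ i ∈ Finset.range (a.natDegree + 1), tint i fun s t =>
            a.coeff i • el q a (h ^ s) ![1] (h ^ t))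
  | 1 =>
    single q a ![0]
      (-el q a y ![0, 2] 1
        + ∑ i ∈ Finset.range (a.natDegree + 1), tint i fun s t =>
            (a.coeff i * q ^ t) • el q a (h ^ s) ![0, 1] (h ^ t)) +
    single q a ![1] (el q a 1 ![0, 1] x - el q a y ![1, 2] 1) +
    single q a ![2]
      (el q a 1 ![0, 2] x
        - ∑ i ∈ Finset.range (a.natDegree + 1), tint i fun s t =>
            (a.coeff i * q ^ s) • el q a (h ^ s) ![1, 2] (h ^ t))
  | 2 =>
    single q a ![0, 1] (el q a y ![0, 1, 2] 1) +
    single q a ![0, 2]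
      (∑ i ∈ Finset.range (a.natDegree + 1), tint i fun s t =>
        (a.coeff i * q ^ (i - 1)) • el q a (h ^ s) ![0, 1, 2] (h ^ t)) +
    single q a ![1, 2] (el q a 1 ![0, 1, 2] x)
  | _ + 3 => 0

/-- The pairs `(j, q)` of total degree `n`: the entry `A|⋀^j V|A` in row `q` sits in bidegree
`(p, q) = (q + j, q)`, hence in total degree `p + q = j + 2q`. -/
abbrev TotIndex (n : ℕ) : Type := {jq : ℕ × ℕ // jq.1 + 2 * jq.2 = n}

/-- The component of degree `n` of the total complex: the direct sum of all `X_{p,q}` with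
`p + q = n` (a finite sum, written as a product). -/
abbrev Tot (n : ℕ) : Type u := ∀ i : TotIndex n, Term q a i.1.1

/-- The differential `d + δ` of the total complex. Its component in bidegree `(p, q)` comes
from `d` on `X_{p+1,q}` and from `δ` on `X_{p,q+1}`; the latter is zero when `p = q`. -/
def totD (n : ℕ) : Tot q a (n + 1) →ₗ[Env k (GWA q a)] Tot q a n :=
  LinearMap.pi fun i =>
    match i with
    | ⟨(0, r), hr⟩ =>
      dHor q a 0 ∘ₗ LinearMap.proj (⟨(1, r), by simp at hr ⊢; omega⟩ : TotIndex (n + 1))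
    | ⟨(j + 1, r), hr⟩ =>
      dHor q a (j + 1) ∘ₗ
          LinearMap.proj (⟨(j + 2, r), by simp at hr ⊢; omega⟩ : TotIndex (n + 1))
        + dVert q a j ∘ₗ
          LinearMap.proj (⟨(j, r + 1), by simp at hr ⊢; omega⟩ : TotIndex (n + 1))

/-- The multiplication map `μ : A|A → A`, `u|v ↦ uv`. -/
def mulMap : Term q a 0 →ₗ[Env k (GWA q a)] GWA q a :=
  ofGen ((coord ![]).smulRight (1 : GWA q a))

/-- The augmentation of the total complex, given by `μ` on `Tot_0 = X_{0,0} = A|A`. -/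
def aug : Tot q a 0 →ₗ[Env k (GWA q a)] GWA q a :=
  mulMap q a ∘ₗ LinearMap.proj (⟨(0, 0), rfl⟩ : TotIndex 0)

end Complex

end QuantumGWA

end

noncomputable section

namespace QuantumGWA

universe u

section Presentations

variable {k : Type u} [Field k]

/-! ### Skew commutation with polynomials -/

/-! The horizontal maps come from a Koszul-type complex `K` of bimodules `B|Λ^j V|B` over the Smith
algebra: each row is `A ⊗_B K ⊗_B A`. Since `A = B/BΩ` with `Ω` central and a non-zero-divisor, the
homology of a row is that of `Tor^B(A, A)`: one copy of `A` in exterior degree 0 and one in exterior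
degree 1. On `K ⊗_B A` the map `δ` squares to zero and is a null-homotopy of `-Ω`, as in the
resolutions over a hypersurface ring. Where `Ω` acts as zero it anticommutes with `d`, and it
carries the degree 0 homology of a row isomorphically to the degree 1 homology of the row below. In
the total complex these cancel in pairs, leaving only `A` in the corner.

An `A^e`-linear map out of `A|W|A` is fixed by its values on `1|w|1`, so in coordinates along basis
words the differentials are matrices in six inner operators: left multiplications by `y`, `h`, `x`
on the right factor and right multiplications on the left factor (`Ops`). The integrals become
divided differences of `a` evaluated at the two copies of `h`. All identities then follow from
normal ordering and from `(v - u) * divDiff a u v = a(v) - a(u)`.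

The same matrices act on `B ⊗ A`, where the complex is exact in positive degrees. Indeed `B` has
basis `H^j X^i Y^n` (proved through a faithful model `Fock`), so `B ⊗ A` is a polynomial module in
which one can divide with unique remainder by the operators of `Y`, then `X`, then `H`; exactness is
elimination (`Ops.Flag.rowExact`). The short exact sequence given by multiplication by `Ω` on `B ⊗
A` with quotient `A ⊗ A` yields the homology of the rows (`Ops.RowExact.reduce`), and a chase in at
most two nonzero components per total degree (`exists_totD`) finishes. -/

theorem aeval_smul {R : Type*} [Ring R] [Algebra k R] (c : k) (r : R) (p : k[X]) :
    Polynomial.aeval (c • r) p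
      = Polynomial.aeval r (p.comp (Polynomial.C c * Polynomial.X)) := by
  rw [Polynomial.aeval_comp]
  simp [Algebra.smul_def]

theorem mul_aeval_of_mul_eq {R : Type*} [Ring R] [Algebra k R] {z u u' : R}
    (hz : z * u = u' * z) (p : k[X]) :
    z * Polynomial.aeval u p = Polynomial.aeval u' p * z := by
  induction p using Polynomial.induction_on' with
  | add p r hp hr => simp only [map_add, mul_add, add_mul, hp, hr]
  | monomial n c =>
    have h : z * u ^ n = u' ^ n * z := (show SemiconjBy z u u' from hz).pow_right n
    rw [Polynomial.aeval_monomial, Polynomial.aeval_monomial, ← mul_assoc,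
      ← Algebra.commutes c z, mul_assoc, h, mul_assoc]

/-- In an algebra with three elements satisfying the relations of the Smith algebra of
`σ(a) - a`, the element `YX - a(H)` commutes with these three elements. -/
theorem commute_casimir {R : Type*} [Ring R] [Algebra k R] {q : k} (a : k[X]) {Y H X : R}
    (hY : H * Y = q • (Y * H)) (hX : X * H = q • (H * X))
    (hXY : X * Y - Y * X = Polynomial.aeval (q • H) a - Polynomial.aeval H a) :
    Commute (Y * X - Polynomial.aeval H a) Y ∧ Commute (Y * X - Polynomial.aeval H a) H ∧
      Commute (Y * X - Polynomial.aeval H a) X := by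
  -- `Ω` has two expressions, `YX - a(H)` and `XY - a(qH)`. Using one on each side of the equation
  -- makes both products `YXY` (respectively `XYX`), and what remains is skew commutation of `Y` or
  -- `X` with polynomials in `H`.
  have hO : Y * X - Polynomial.aeval H a = X * Y - Polynomial.aeval (q • H) a := by
    rw [sub_eq_sub_iff_add_eq_add, ← sub_eq_sub_iff_add_eq_add.1 hXY.symm]
    abel
  have h1 := mul_aeval_of_mul_eq (z := Y) (u := q • H) (u' := H) (by simp [hY]) a
  have h2 := mul_aeval_of_mul_eq (z := X) (u := H) (u' := q • H) (by simp [hX]) a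
  refine ⟨?_, ?_, ?_⟩
  · change (Y * X - Polynomial.aeval H a) * Y = Y * (Y * X - Polynomial.aeval H a)
    conv_rhs => rw [hO]
    rw [sub_mul, mul_sub, mul_assoc, h1]
  · refine Commute.sub_left ?_ ?_
    · change Y * X * H = H * (Y * X)
      rw [mul_assoc, hX, ← mul_assoc H, hY, mul_smul_comm, smul_mul_assoc, mul_assoc]
    · exact mul_aeval_of_mul_eq (rfl : H * H = H * H) a |>.symm
  · change (Y * X - Polynomial.aeval H a) * X = X * (Y * X - Polynomial.aeval H a)
    conv_lhs => rw [hO]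
    rw [sub_mul, mul_sub, mul_assoc, h2]

/-! ### Relations and universal properties -/

variable (q : k) (a l : k[X])

theorem GWA.hy : GWA.gen q a 1 * GWA.gen q a 0 = q • (GWA.gen q a 0 * GWA.gen q a 1) := by
  have := RingQuot.mkAlgHom_rel k (GWARel.hy (q := q) (a := a))
  rw [map_mul, map_smul, map_mul] at this
  exact this

theorem GWA.xh : GWA.gen q a 2 * GWA.gen q a 1 = q • (GWA.gen q a 1 * GWA.gen q a 2) := by
  have := RingQuot.mkAlgHom_rel k (GWARel.xh (q := q) (a := a))
  rw [map_mul, map_smul, map_mul] at this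
  exact this

theorem GWA.yx : GWA.gen q a 0 * GWA.gen q a 2 = Polynomial.aeval (GWA.gen q a 1) a := by
  have := RingQuot.mkAlgHom_rel k (GWARel.yx (q := q) (a := a))
  rw [map_mul, ← Polynomial.aeval_algHom_apply] at this
  exact this

theorem GWA.xy : GWA.gen q a 2 * GWA.gen q a 0 = Polynomial.aeval (q • GWA.gen q a 1) a := by
  have := RingQuot.mkAlgHom_rel k (GWARel.xy (q := q) (a := a))
  rw [map_mul, ← Polynomial.aeval_algHom_apply, map_smul] at this
  exact this

theorem Smith.hy :
    Smith.gen q l 1 * Smith.gen q l 0 = q • (Smith.gen q l 0 * Smith.gen q l 1) := by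
  have := RingQuot.mkAlgHom_rel k (SmithRel.hy (q := q) (l := l))
  rw [map_mul, map_smul, map_mul] at this
  exact this

theorem Smith.xh :
    Smith.gen q l 2 * Smith.gen q l 1 = q • (Smith.gen q l 1 * Smith.gen q l 2) := by
  have := RingQuot.mkAlgHom_rel k (SmithRel.xh (q := q) (l := l))
  rw [map_mul, map_smul, map_mul] at this
  exact this

theorem Smith.xy :
    Smith.gen q l 2 * Smith.gen q l 0 - Smith.gen q l 0 * Smith.gen q l 2
      = Polynomial.aeval (Smith.gen q l 1) l := by
  have := RingQuot.mkAlgHom_rel k (SmithRel.xy (q := q) (l := l))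
  rw [map_sub, map_mul, map_mul, ← Polynomial.aeval_algHom_apply] at this
  exact this

theorem aeval_smithPoly {R : Type*} [Ring R] [Algebra k R] (r : R) :
    Polynomial.aeval r (smithPoly q a) = Polynomial.aeval (q • r) a - Polynomial.aeval r a := by
  rw [smithPoly, map_sub, aeval_smul]

variable {q a l}

/-- The algebra map out of `A(a, q)` given by elements satisfying the relations. -/
def GWA.lift {R : Type*} [Ring R] [Algebra k R] (g : Fin 3 → R)
    (hxh : g 2 * g 1 = q • (g 1 * g 2)) (hyx : g 0 * g 2 = Polynomial.aeval (g 1) a)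
    (hhy : g 1 * g 0 = q • (g 0 * g 1)) (hxy : g 2 * g 0 = Polynomial.aeval (q • g 1) a) :
    GWA q a →ₐ[k] R :=
  RingQuot.liftAlgHom k ⟨FreeAlgebra.lift k g, by
    rintro _ _ (_ | _ | _ | _)
    · simpa using hxh
    · simpa [← Polynomial.aeval_algHom_apply] using hyx
    · simpa using hhy
    · simpa [← Polynomial.aeval_algHom_apply] using hxy⟩

theorem GWA.lift_gen {R : Type*} [Ring R] [Algebra k R] (g : Fin 3 → R)
    (hxh : g 2 * g 1 = q • (g 1 * g 2)) (hyx : g 0 * g 2 = Polynomial.aeval (g 1) a)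
    (hhy : g 1 * g 0 = q • (g 0 * g 1)) (hxy : g 2 * g 0 = Polynomial.aeval (q • g 1) a)
    (i : Fin 3) : GWA.lift g hxh hyx hhy hxy (GWA.gen q a i) = g i := by
  refine (RingQuot.liftAlgHom_mkAlgHom_apply k _ _ _).trans ?_
  simp

/-- The algebra map out of the Smith algebra given by elements satisfying the relations. -/
def Smith.lift {R : Type*} [Ring R] [Algebra k R] (g : Fin 3 → R)
    (hhy : g 1 * g 0 = q • (g 0 * g 1))
    (hxy : g 2 * g 0 - g 0 * g 2 = Polynomial.aeval (g 1) l)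
    (hxh : g 2 * g 1 = q • (g 1 * g 2)) :
    Smith q l →ₐ[k] R :=
  RingQuot.liftAlgHom k ⟨FreeAlgebra.lift k g, by
    rintro _ _ (_ | _ | _)
    · simpa using hhy
    · simpa [← Polynomial.aeval_algHom_apply] using hxy
    · simpa using hxh⟩

theorem Smith.lift_gen {R : Type*} [Ring R] [Algebra k R] (g : Fin 3 → R)
    (hhy : g 1 * g 0 = q • (g 0 * g 1))
    (hxy : g 2 * g 0 - g 0 * g 2 = Polynomial.aeval (g 1) l)
    (hxh : g 2 * g 1 = q • (g 1 * g 2)) (i : Fin 3) :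
    Smith.lift g hhy hxy hxh (Smith.gen q l i) = g i := by
  refine (RingQuot.liftAlgHom_mkAlgHom_apply k _ _ _).trans ?_
  simp

theorem GWA.mem_of_gen_mem (S : Subalgebra k (GWA q a)) (hS : ∀ i, GWA.gen q a i ∈ S)
    (b : GWA q a) : b ∈ S := by
  obtain ⟨f, rfl⟩ := RingQuot.mkAlgHom_surjective k (GWARel q a) b
  induction f using FreeAlgebra.induction with
  | grade0 r => rw [AlgHom.commutes]; exact S.algebraMap_mem r
  | grade1 i => exact hS i
  | mul f g hf hg => rw [map_mul]; exact S.mul_mem hf hg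
  | add f g hf hg => rw [map_add]; exact S.add_mem hf hg

theorem Smith.mem_of_gen_mem (S : Subalgebra k (Smith q l)) (hS : ∀ i, Smith.gen q l i ∈ S)
    (b : Smith q l) : b ∈ S := by
  obtain ⟨f, rfl⟩ := RingQuot.mkAlgHom_surjective k (SmithRel q l) b
  induction f using FreeAlgebra.induction with
  | grade0 r => rw [AlgHom.commutes]; exact S.algebraMap_mem r
  | grade1 i => exact hS i
  | mul f g hf hg => rw [map_mul]; exact S.mul_mem hf hg
  | add f g hf hg => rw [map_add]; exact S.add_mem hf hg

theorem Smith.algHom_ext {R : Type*} [Ring R] [Algebra k R] {f g : Smith q l →ₐ[k] R}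
    (hfg : ∀ i, f (Smith.gen q l i) = g (Smith.gen q l i)) : f = g :=
  AlgHom.ext fun b => Smith.mem_of_gen_mem (AlgHom.equalizer f g) hfg b

/-! ### `A` is the quotient of `B` by the central element `Ω` -/

variable (q a)

theorem omega_mem_center : Omega q a ∈ Subalgebra.center k (Smith q (smithPoly q a)) := by
  have h := commute_casimir a (Smith.hy q (smithPoly q a)) (Smith.xh q (smithPoly q a))
    ((Smith.xy q (smithPoly q a)).trans (aeval_smithPoly q a _))
  rw [Subalgebra.mem_center_iff]
  intro b
  have := Smith.mem_of_gen_mem (Subalgebra.centralizer k {Omega q a}) (fun i => ?_) b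
  · exact (Subalgebra.mem_centralizer_iff k |>.1 this _ rfl).symm
  · rw [Subalgebra.mem_centralizer_iff]
    rintro _ rfl
    fin_cases i
    exacts [h.1, h.2.1, h.2.2]

/-- The projection `B → A` sending generators to generators. -/
def smithToGWA : Smith q (smithPoly q a) →ₐ[k] GWA q a :=
  Smith.lift (GWA.gen q a) (GWA.hy q a)
    (by rw [aeval_smithPoly, GWA.xy, GWA.yx]) (GWA.xh q a)

theorem smithToGWA_gen (i : Fin 3) :
    smithToGWA q a (Smith.gen q (smithPoly q a) i) = GWA.gen q a i :=
  Smith.lift_gen _ _ _ _ i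

theorem smithToGWA_surjective : Function.Surjective (smithToGWA q a) := by
  intro b
  exact GWA.mem_of_gen_mem (smithToGWA q a).range (fun i => ⟨_, smithToGWA_gen q a i⟩) b

theorem smithToGWA_omega : smithToGWA q a (Omega q a) = 0 := by
  rw [Omega, map_sub, map_mul, ← Polynomial.aeval_algHom_apply]
  simp only [smithToGWA_gen]
  rw [GWA.yx, sub_self]

/-- As `Ω` is central, the multiples `cΩ` form a two-sided ideal. The generators of the quotient
satisfy the relations of `A`, so the quotient map factors through `B → A` and the kernel cannot be
larger. -/
theorem smithToGWA_eq_zero_iff (b : Smith q (smithPoly q a)) :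
    smithToGWA q a b = 0 ↔ ∃ c, b = c * Omega q a := by
  constructor
  · intro hb
    have hcomm : ∀ c, c * Omega q a = Omega q a * c :=
      Subalgebra.mem_center_iff.1 (omega_mem_center q a)
    let I : TwoSidedIdeal (Smith q (smithPoly q a)) :=
      TwoSidedIdeal.mk' {b | ∃ c, b = c * Omega q a} ⟨0, by simp⟩
        (by rintro _ _ ⟨c, rfl⟩ ⟨d, rfl⟩; exact ⟨c + d, by rw [add_mul]⟩)
        (by rintro _ ⟨c, rfl⟩; exact ⟨-c, by rw [neg_mul]⟩)
        (by rintro r _ ⟨c, rfl⟩; exact ⟨r * c, by rw [mul_assoc]⟩)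
        (by rintro _ r ⟨c, rfl⟩; exact ⟨c * r, by rw [mul_assoc, mul_assoc, hcomm r]⟩)
    have hI : ∀ b, b ∈ I ↔ ∃ c, b = c * Omega q a := fun b => TwoSidedIdeal.mem_mk' ..
    let p : Smith q (smithPoly q a) →ₐ[k] I.ringCon.Quotient :=
      { I.ringCon.mk' with commutes' := fun _ => rfl }
    have hp : ∀ b, p b = 0 ↔ b ∈ I := fun b => by
      rw [TwoSidedIdeal.mem_iff]
      exact RingCon.eq I.ringCon
    have hyx : p (Smith.gen q _ 0) * p (Smith.gen q _ 2)
        = Polynomial.aeval (p (Smith.gen q _ 1)) a := by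
      rw [Polynomial.aeval_algHom_apply, ← map_mul, ← sub_eq_zero, ← map_sub, hp, hI]
      exact ⟨1, (one_mul _).symm⟩
    let s : GWA q a →ₐ[k] I.ringCon.Quotient :=
      GWA.lift (fun i => p (Smith.gen q _ i))
        (by simp only [← map_mul, ← map_smul, Smith.xh]) hyx
        (by simp only [← map_mul, ← map_smul, Smith.hy])
        -- The relation `xy = a(qh)` is not imposed separately: it is `XY - YX = a(qH) - a(H)`
        -- combined with `YX = a(H)` in the quotient.
        (by
          have h := congrArg p (Smith.xy q (smithPoly q a))
          rw [aeval_smithPoly, map_sub, map_sub, map_mul, map_mul, hyx,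
            Polynomial.aeval_algHom_apply, sub_left_inj] at h
          rw [h, ← map_smul, Polynomial.aeval_algHom_apply])
    have hs : s.comp (smithToGWA q a) = p := Smith.algHom_ext fun i => by
      rw [AlgHom.comp_apply, smithToGWA_gen]
      exact GWA.lift_gen _ _ _ _ _ i
    rw [← hI, ← hp, ← hs, AlgHom.comp_apply, hb, map_zero]
  · rintro ⟨c, rfl⟩
    rw [map_mul, smithToGWA_omega, mul_zero]

end Presentations

/-! ### Divided differences -/

section DivDiff

variable {k : Type*} [Field k]

/-- The sum `∑ i, ∑_{s + t + 1 = i} a_i u ^ s v ^ t`, which for commuting `u`, `v` is the divided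
difference `(a(v) - a(u)) / (v - u)`. -/
def divDiff {R : Type*} [Ring R] [Algebra k R] (a : k[X]) (u v : R) : R :=
  ∑ i ∈ Finset.range (a.natDegree + 1), ∑ s ∈ Finset.range i,
    a.coeff i • (u ^ s * v ^ (i - 1 - s))

theorem semiconjBy_divDiff {R : Type*} [Ring R] [Algebra k R] (a : k[X]) {z u u' v v' : R}
    (hu : SemiconjBy z u u') (hv : SemiconjBy z v v') :
    SemiconjBy z (divDiff a u v) (divDiff a u' v') := by
  simp only [SemiconjBy, divDiff, Finset.mul_sum, Finset.sum_mul, mul_smul_comm, smul_mul_assoc]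
  refine Finset.sum_congr rfl fun i _ => Finset.sum_congr rfl fun s _ => ?_
  rw [((hu.pow_right s).mul_right (hv.pow_right _)).eq]

theorem sub_mul_divDiff {R : Type*} [Ring R] [Algebra k R] (a : k[X]) {u v : R}
    (h : Commute u v) :
    (v - u) * divDiff a u v = Polynomial.aeval v a - Polynomial.aeval u a := by
  rw [Polynomial.aeval_eq_sum_range, Polynomial.aeval_eq_sum_range, ← Finset.sum_sub_distrib,
    divDiff, Finset.mul_sum]
  refine Finset.sum_congr rfl fun i _ => ?_
  have := h.mul_neg_geom_sum₂ i
  rw [← Finset.smul_sum, mul_smul_comm, ← smul_sub, this]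

end DivDiff

/-! ### The complexes attached to two commuting actions of `Y`, `H`, `X` -/

section Ops

/-- Six operators on a vector space, to be thought of as the left and right multiplications
by `y`, `h`, `x`. -/
structure Ops (k : Type*) [Field k] (E : Type*) [AddCommGroup E] [Module k E] where
  (ly lh lx ry rh rx : Module.End k E)

variable {k : Type*} [Field k] {E : Type*} [AddCommGroup E] [Module k E]
  {E' : Type*} [AddCommGroup E'] [Module k E']

/-- The left multiplications satisfy the relations of `A(a, q)`, the right ones those of the
Smith algebra of `σ(a) - a`, and the former commute with the latter. -/
structure Ops.IsSmith (O : Ops k E) (q : k) (a : k[X]) : Prop where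
  ry_ly : Commute O.ry O.ly
  ry_lh : Commute O.ry O.lh
  ry_lx : Commute O.ry O.lx
  rh_ly : Commute O.rh O.ly
  rh_lh : Commute O.rh O.lh
  rh_lx : Commute O.rh O.lx
  rx_ly : Commute O.rx O.ly
  rx_lh : Commute O.rx O.lh
  rx_lx : Commute O.rx O.lx
  lh_ly : O.lh * O.ly = q • (O.ly * O.lh)
  lx_lh : O.lx * O.lh = q • (O.lh * O.lx)
  ly_lx : O.ly * O.lx = Polynomial.aeval O.lh a
  lx_ly : O.lx * O.ly = Polynomial.aeval (q • O.lh) a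
  rh_rx : O.rh * O.rx = q • (O.rx * O.rh)
  ry_rh : O.ry * O.rh = q • (O.rh * O.ry)
  ry_rx : O.ry * O.rx - O.rx * O.ry = Polynomial.aeval (q • O.rh) a - Polynomial.aeval O.rh a

/-- Right multiplication by `YX - a(H)`. -/
def Ops.casimir (O : Ops k E) (a : k[X]) : Module.End k E := O.rx * O.ry - Polynomial.aeval O.rh a

/-- The divided difference of `a` at `c h` on the left factor and `e h` on the right factor. -/
def Ops.diff (O : Ops k E) (a : k[X]) (c e : k) : Module.End k E :=
  divDiff a (c • O.rh) (e • O.lh)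

/-- Horizontal differential on coordinates along `Y`, `H`, `X`. -/
def Ops.d₁ (O : Ops k E) : E × E × E →ₗ[k] E :=
  (O.ly - O.ry).coprod ((O.lh - O.rh).coprod (O.lx - O.rx))

/-- Horizontal differential, from coordinates along `H ∧ X`, `Y ∧ X`, `Y ∧ H` to coordinates along
`Y`, `H`, `X`. -/
def Ops.d₂ (O : Ops k E) (q : k) (a : k[X]) : E × E × E →ₗ[k] E × E × E :=
  (LinearMap.coprod 0 ((-(O.lx - O.rx)).coprod (-(q • O.lh - O.rh)))).prod
    (((-(q • O.lx - O.rx)).coprod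
      ((-(q • O.diff a q q - O.diff a 1 1)).coprod (O.ly - q • O.ry))).prod
    ((O.lh - q • O.rh).coprod ((O.ly - O.ry).coprod 0)))

/-- Horizontal differential on the coordinate along `Y ∧ H ∧ X`. -/
def Ops.d₃ (O : Ops k E) (q : k) : E →ₗ[k] E × E × E :=
  (O.ly - q • O.ry).prod ((-(q • (O.lh - O.rh))).prod (q • O.lx - O.rx))

/-- Vertical differential in exterior degree zero. -/
def Ops.δ₀ (O : Ops k E) (a : k[X]) : E →ₗ[k] E × E × E :=
  O.lx.prod ((-O.diff a 1 1).prod O.ry)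

/-- Vertical differential in exterior degree one. -/
def Ops.δ₁ (O : Ops k E) (q : k) (a : k[X]) : E × E × E →ₗ[k] E × E × E :=
  (LinearMap.coprod 0 ((-O.ry).coprod (-O.diff a q 1))).prod
    (((-O.ry).coprod (LinearMap.coprod 0 O.lx)).prod
      ((O.diff a 1 q).coprod (O.lx.coprod 0)))

/-- Vertical differential in exterior degree two. -/
def Ops.δ₂ (O : Ops k E) (q : k) (a : k[X]) : E × E × E →ₗ[k] E :=
  O.lx.coprod ((O.diff a q q).coprod O.ry)

section apply

variable (O : Ops k E) (q : k) (a : k[X]) (f g e : E)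

theorem Ops.d₁_apply :
    O.d₁ (f, g, e) = (O.ly f - O.ry f) + ((O.lh g - O.rh g) + (O.lx e - O.rx e)) := rfl

theorem Ops.d₂_apply :
    O.d₂ q a (f, g, e) =
      (-(O.lx g - O.rx g) - (q • O.lh e - O.rh e),
        -(q • O.lx f - O.rx f) - (q • O.diff a q q g - O.diff a 1 1 g) + (O.ly e - q • O.ry e),
        (O.lh f - q • O.rh f) + (O.ly g - O.ry g)) := by
  simp [Ops.d₂]; abel_nf; simp

theorem Ops.d₃_apply :
    O.d₃ q e = (O.ly e - q • O.ry e, -(q • (O.lh e - O.rh e)), q • O.lx e - O.rx e) := rfl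

theorem Ops.δ₀_apply : O.δ₀ a e = (O.lx e, -O.diff a 1 1 e, O.ry e) := rfl

theorem Ops.δ₁_apply :
    O.δ₁ q a (f, g, e) =
      (-O.ry g - O.diff a q 1 e, -O.ry f + O.lx e, O.diff a 1 q f + O.lx g) := by
  simp [Ops.δ₁, sub_eq_add_neg]

theorem Ops.δ₂_apply :
    O.δ₂ q a (f, g, e) = O.lx f + (O.diff a q q g + O.ry e) := rfl

end apply

set_option linter.unusedSimpArgs false

/-! ### Identities among the horizontal and vertical matrices -/

namespace Ops.IsSmith

variable {O : Ops k E} {q : k} {a : k[X]} (hO : O.IsSmith q a)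
include hO

theorem lh_diff (c e : k) : Commute O.lh (O.diff a c e) :=
  semiconjBy_divDiff a (hO.rh_lh.symm.smul_right c) ((Commute.refl _).smul_right e)

theorem rh_diff (c e : k) : Commute O.rh (O.diff a c e) :=
  semiconjBy_divDiff a ((Commute.refl _).smul_right c) (hO.rh_lh.smul_right e)

theorem lx_diff (c e : k) : O.lx * O.diff a c e = O.diff a c (q * e) * O.lx :=
  semiconjBy_divDiff a (hO.rh_lx.symm.smul_right c) (by
    simp [SemiconjBy, hO.lx_lh, smul_smul, mul_comm])

theorem ry_diff (c e : k) : O.ry * O.diff a c e = O.diff a (q * c) e * O.ry :=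
  semiconjBy_divDiff a (by simp [SemiconjBy, hO.ry_rh, smul_smul, mul_comm])
    (hO.ry_lh.smul_right e)

theorem diff_ly (c e : k) : O.diff a c e * O.ly = O.ly * O.diff a c (q * e) :=
  (semiconjBy_divDiff a (hO.rh_ly.symm.smul_right c) (by
    simp [SemiconjBy, hO.lh_ly, smul_smul, mul_comm]) : O.ly * O.diff a c (q * e) = _).symm

theorem diff_rx (c e : k) : O.diff a c e * O.rx = O.rx * O.diff a (q * c) e :=
  (semiconjBy_divDiff a (by simp [SemiconjBy, hO.rh_rx, smul_smul, mul_comm])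
    (hO.rx_lh.smul_right e) : O.rx * O.diff a (q * c) e = _).symm

theorem sub_mul_diff (c e : k) :
    (e • O.lh - c • O.rh) * O.diff a c e
      = Polynomial.aeval (e • O.lh) a - Polynomial.aeval (c • O.rh) a :=
  sub_mul_divDiff a ((hO.rh_lh.smul_left c).smul_right e)

/-- Normal ordering rules, elementwise. -/
theorem rules : (∀ e, O.ry (O.ly e) = O.ly (O.ry e)) ∧ (∀ e, O.ry (O.lh e) = O.lh (O.ry e)) ∧
    (∀ e, O.ry (O.lx e) = O.lx (O.ry e)) ∧ (∀ e, O.rh (O.ly e) = O.ly (O.rh e)) ∧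
    (∀ e, O.rh (O.lh e) = O.lh (O.rh e)) ∧ (∀ e, O.rh (O.lx e) = O.lx (O.rh e)) ∧
    (∀ e, O.rx (O.ly e) = O.ly (O.rx e)) ∧ (∀ e, O.rx (O.lh e) = O.lh (O.rx e)) ∧
    (∀ e, O.rx (O.lx e) = O.lx (O.rx e)) ∧ (∀ e, O.lh (O.ly e) = q • O.ly (O.lh e)) ∧
    (∀ e, O.lx (O.lh e) = q • O.lh (O.lx e)) ∧
    (∀ e, O.ly (O.lx e) = Polynomial.aeval O.lh a e) ∧
    (∀ e, O.lx (O.ly e) = Polynomial.aeval (q • O.lh) a e) ∧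
    (∀ e, O.rh (O.rx e) = q • O.rx (O.rh e)) ∧ (∀ e, O.ry (O.rh e) = q • O.rh (O.ry e)) ∧
    (∀ e, O.ry (O.rx e) = O.rx (O.ry e) + Polynomial.aeval (q • O.rh) a e
      - Polynomial.aeval O.rh a e) := by
  refine ⟨LinearMap.congr_fun hO.ry_ly, LinearMap.congr_fun hO.ry_lh,
    LinearMap.congr_fun hO.ry_lx, LinearMap.congr_fun hO.rh_ly, LinearMap.congr_fun hO.rh_lh,
    LinearMap.congr_fun hO.rh_lx, LinearMap.congr_fun hO.rx_ly, LinearMap.congr_fun hO.rx_lh,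
    LinearMap.congr_fun hO.rx_lx, LinearMap.congr_fun hO.lh_ly, LinearMap.congr_fun hO.lx_lh,
    LinearMap.congr_fun hO.ly_lx, LinearMap.congr_fun hO.lx_ly, LinearMap.congr_fun hO.rh_rx,
    LinearMap.congr_fun hO.ry_rh, fun e => ?_⟩
  have : O.ry (O.rx e) - O.rx (O.ry e) = _ := LinearMap.congr_fun hO.ry_rx e
  rw [LinearMap.sub_apply] at this
  linear_combination (norm := module) this

/-- The operators of `x` and `y` pass a divided difference at the cost of rescaling one of its two
nodes by `q`; this is where the powers `q^s`, `q^t` in `δ` come from. The last clause is the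
telescoping identity, the only input beyond normal ordering. -/
theorem diff_rules : (∀ c f e, O.lh (O.diff a c f e) = O.diff a c f (O.lh e)) ∧
    (∀ c f e, O.rh (O.diff a c f e) = O.diff a c f (O.rh e)) ∧
    (∀ c f e, O.lx (O.diff a c f e) = O.diff a c (q * f) (O.lx e)) ∧
    (∀ c f e, O.ry (O.diff a c f e) = O.diff a (q * c) f (O.ry e)) ∧
    (∀ c f e, O.diff a c f (O.ly e) = O.ly (O.diff a c (q * f) e)) ∧
    (∀ c f e, O.diff a c f (O.rx e) = O.rx (O.diff a (q * c) f e)) ∧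
    (∀ c f e, f • O.diff a c f (O.lh e) - c • O.diff a c f (O.rh e)
      = Polynomial.aeval (f • O.lh) a e - Polynomial.aeval (c • O.rh) a e) := by
  refine ⟨fun c f => LinearMap.congr_fun (hO.lh_diff c f),
    fun c f => LinearMap.congr_fun (hO.rh_diff c f),
    fun c f => LinearMap.congr_fun (hO.lx_diff c f),
    fun c f => LinearMap.congr_fun (hO.ry_diff c f),
    fun c f => LinearMap.congr_fun (hO.diff_ly c f),
    fun c f => LinearMap.congr_fun (hO.diff_rx c f), fun c f e => ?_⟩
  have : f • O.lh (O.diff a c f e) - c • O.rh (O.diff a c f e) = _ :=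
    LinearMap.congr_fun (hO.sub_mul_diff c f) e
  have h1 : O.lh (O.diff a c f e) = O.diff a c f (O.lh e) :=
    LinearMap.congr_fun (hO.lh_diff c f) e
  have h2 : O.rh (O.diff a c f e) = O.diff a c f (O.rh e) :=
    LinearMap.congr_fun (hO.rh_diff c f) e
  rw [← h1, ← h2]
  exact this

theorem d₁_d₂ (v : E × E × E) : O.d₁ (O.d₂ q a v) = 0 := by
  obtain ⟨f, g, e⟩ := v
  obtain ⟨h1, h2, h3, h4, h5, h6, h7, h8, h9, h10, h11, h12, h13, h14, h15, h16⟩ := hO.rules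
  obtain ⟨k1, k2, k3, k4, k5, k6, k7⟩ := hO.diff_rules
  have e1 := k7 1 1 g
  have e2 := k7 q q g
  simp only [one_smul] at e1
  simp only [Ops.d₂_apply, Ops.d₁_apply, map_add, map_sub, map_neg, map_smul, h1, h2, h3, h4, h5,
    h6, h7, h8, h9, h10, h11, h12, h13, h14, h15, h16, k1, k2, k3, k4, k5, k6]
  -- After normal ordering the commutators of `X` and `Y` on the two sides leave `a(qh) - a(h)` at
  -- `lh` and at `rh`. The integral with the coefficients `λ_i` is `q • diff a q q - diff a 1 1`,
  -- and telescoping each part cancels these terms.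
  linear_combination (norm := module) e1 - e2

theorem d₂_d₃ (e : E) : O.d₂ q a (O.d₃ q e) = 0 := by
  obtain ⟨h1, h2, h3, h4, h5, h6, h7, h8, h9, h10, h11, h12, h13, h14, h15, h16⟩ := hO.rules
  obtain ⟨k1, k2, k3, k4, k5, k6, k7⟩ := hO.diff_rules
  have e1 := k7 1 1 e
  have e2 := k7 q q e
  simp only [one_smul] at e1
  simp only [Ops.d₂_apply, Ops.d₃_apply, map_add, map_sub, map_neg, map_smul, h1, h2, h3, h4, h5,
    h6, h7, h8, h9, h10, h11, h12, h13, h14, h15, h16, k1, k2, k3, k4, k5, k6]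
  refine Prod.ext ?_ (Prod.ext ?_ ?_)
  · simp only [Prod.fst_zero]
    module
  · simp only [Prod.snd_zero, Prod.fst_zero]
    linear_combination (norm := module) q • e2 - q • e1
  · simp only [Prod.snd_zero]
    module

/-- Over `B ⊗ A` the element `δ(1|1)` is not a cycle: its boundary is `-Ω`. Modulo `Ω` it becomes a
cycle whose connecting image is, up to sign, the generator of degree 0; hence it generates the
degree 1 homology of a row. -/
theorem d₁_δ₀ (e : E) : O.d₁ (O.δ₀ a e) = -O.casimir a e := by
  obtain ⟨h1, h2, h3, h4, h5, h6, h7, h8, h9, h10, h11, h12, h13, h14, h15, h16⟩ := hO.rules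
  obtain ⟨k1, k2, k3, k4, k5, k6, k7⟩ := hO.diff_rules
  have e1 := k7 1 1 e
  simp only [one_smul] at e1
  have hc : O.casimir a e = O.rx (O.ry e) - Polynomial.aeval O.rh a e := rfl
  rw [hc]
  simp only [Ops.δ₀_apply, Ops.d₁_apply, map_add, map_sub, map_neg, map_smul, h1, h2, h3, h4, h5,
    h6, h7, h8, h9, h10, h11, h12, h13, h14, h15, h16, k1, k2, k3, k4, k5, k6]
  linear_combination (norm := module) -e1

theorem δ₁_δ₀ (e : E) : O.δ₁ q a (O.δ₀ a e) = 0 := by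
  obtain ⟨h1, h2, h3, h4, h5, h6, h7, h8, h9, h10, h11, h12, h13, h14, h15, h16⟩ := hO.rules
  obtain ⟨k1, k2, k3, k4, k5, k6, k7⟩ := hO.diff_rules
  simp only [Ops.δ₀_apply, Ops.δ₁_apply, map_neg, h3, k3, k4, mul_one]
  refine Prod.ext ?_ (Prod.ext ?_ ?_) <;> simp

theorem δ₂_δ₁ (v : E × E × E) : O.δ₂ q a (O.δ₁ q a v) = 0 := by
  obtain ⟨f, g, e⟩ := v
  obtain ⟨h1, h2, h3, h4, h5, h6, h7, h8, h9, h10, h11, h12, h13, h14, h15, h16⟩ := hO.rules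
  obtain ⟨k1, k2, k3, k4, k5, k6, k7⟩ := hO.diff_rules
  simp only [Ops.δ₂_apply, Ops.δ₁_apply, map_add, map_sub, map_neg, h3, k3, k4, mul_one]
  abel

/-- Here and in the next two lemmas the expression equals minus the Casimir operator before `hc` is
used: `δ` is a null-homotopy of multiplication by `-Ω`. -/
theorem δ₂_d₃ (hc : O.casimir a = 0) (e : E) : O.δ₂ q a (O.d₃ q e) = 0 := by
  obtain ⟨h1, h2, h3, h4, h5, h6, h7, h8, h9, h10, h11, h12, h13, h14, h15, h16⟩ := hO.rules
  obtain ⟨k1, k2, k3, k4, k5, k6, k7⟩ := hO.diff_rules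
  have e2 := k7 q q e
  have hc' : O.rx (O.ry e) - Polynomial.aeval O.rh a e = 0 := LinearMap.congr_fun hc e
  simp only [Ops.δ₂_apply, Ops.d₃_apply, map_add, map_sub, map_neg, map_smul, h1, h2, h3, h4, h5,
    h6, h7, h8, h9, h10, h11, h12, h13, h14, h15, h16, k1, k2, k3, k4, k5, k6]
  linear_combination (norm := module) -e2 - hc'

theorem d₂_δ₁ (hc : O.casimir a = 0) (v : E × E × E) :
    O.d₂ q a (O.δ₁ q a v) + O.δ₀ a (O.d₁ v) = 0 := by
  obtain ⟨f, g, e⟩ := v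
  obtain ⟨h1, h2, h3, h4, h5, h6, h7, h8, h9, h10, h11, h12, h13, h14, h15, h16⟩ := hO.rules
  obtain ⟨k1, k2, k3, k4, k5, k6, k7⟩ := hO.diff_rules
  have hc' : ∀ e, O.rx (O.ry e) = Polynomial.aeval O.rh a e :=
    fun e => sub_eq_zero.1 (LinearMap.congr_fun hc e)
  have e1 := k7 1 q f
  have e2 := k7 1 1 g
  have e3 := k7 q 1 e
  simp only [one_smul] at e1 e2 e3
  simp only [Ops.δ₁_apply, Ops.δ₀_apply, Ops.d₁_apply, Ops.d₂_apply, map_add, map_sub, map_neg,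
    map_smul, h1, h2, h3, h4, h5, hc',
    h6, h7, h8, h9, h10, h11, h12, h13, h14, h15, h16, k1, k2, k3, k4, k5, k6, mul_one]
  refine Prod.ext ?_ (Prod.ext ?_ ?_)
  · simp only [Prod.fst_zero, Prod.fst_add, Prod.fst_sub]
    linear_combination (norm := module) -e1
  · simp only [Prod.snd_zero, Prod.fst_zero, Prod.snd_add, Prod.fst_add, Prod.fst_sub, Prod.snd_sub]
    linear_combination (norm := module) -e2
  · simp only [Prod.snd_zero, Prod.snd_add, Prod.snd_sub]
    linear_combination (norm := module) -e3

theorem d₃_δ₂ (hc : O.casimir a = 0) (v : E × E × E) :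
    O.d₃ q (O.δ₂ q a v) + O.δ₁ q a (O.d₂ q a v) = 0 := by
  obtain ⟨f, g, e⟩ := v
  obtain ⟨h1, h2, h3, h4, h5, h6, h7, h8, h9, h10, h11, h12, h13, h14, h15, h16⟩ := hO.rules
  obtain ⟨k1, k2, k3, k4, k5, k6, k7⟩ := hO.diff_rules
  have hc' : ∀ e, O.rx (O.ry e) = Polynomial.aeval O.rh a e :=
    fun e => sub_eq_zero.1 (LinearMap.congr_fun hc e)
  have e1 := k7 q 1 f
  have e2 := k7 q q g
  have e3 := k7 1 q e
  have e4 := k7 q 1 g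
  have e5 := k7 1 q g
  have e6 := k7 1 1 g
  simp only [one_smul] at e1 e2 e3 e4 e5 e6
  simp only [Ops.δ₁_apply, Ops.δ₂_apply, Ops.d₃_apply, Ops.d₂_apply, map_add, map_sub, map_neg,
    map_smul, h1, h2, h3, h4, h5, hc',
    h6, h7, h8, h9, h10, h11, h12, h13, h14, h15, h16, k1, k2, k3, k4, k5, k6, mul_one]
  refine Prod.ext ?_ (Prod.ext ?_ ?_)
  · simp only [Prod.fst_zero, Prod.fst_add]
    linear_combination (norm := module) -e1
  · simp only [Prod.snd_zero, Prod.fst_zero, Prod.snd_add, Prod.fst_add]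
    linear_combination (norm := module) -e2
  · simp only [Prod.snd_zero, Prod.snd_add]
    linear_combination (norm := module) -e3

end Ops.IsSmith

end Ops

/-! ### Division with unique remainder -/

section Division

variable {k : Type*} [Field k] {S D M : Type*} [AddCommGroup S] [Module k S]
  [AddCommGroup D] [Module k D] [AddCommGroup M] [Module k M]

/-- Every element of `D` is uniquely of the form `i s + φ e`. -/
structure IsDivision (i : S →ₗ[k] D) (φ : Module.End k D) : Prop where
  exists_eq : ∀ d, ∃ s e, d = i s + φ e
  unique : ∀ s e, i s + φ e = 0 → s = 0 ∧ e = 0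

theorem IsDivision.injective {i : S →ₗ[k] D} {φ : Module.End k D} (h : IsDivision i φ) {e : D}
    (he : φ e = 0) : e = 0 :=
  (h.unique 0 e (by rw [map_zero, zero_add, he])).2

/-- Descending induction starting beyond the finite support. It gives injectivity both for division
operators and for multiplication by `Ω`. -/
theorem Finsupp.eq_zero_of_forall_succ {M : Type*} [Zero M] (e : ℕ →₀ M)
    (h : ∀ n, e (n + 1) = 0 → e n = 0) : e = 0 := by
  have hm : ∀ m n, e (n + m) = 0 → e n = 0 := fun m => by
    induction m with
    | zero => exact fun n hn => hn
    | succ m ih => exact fun n hn => ih n (h _ hn)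
  ext n
  obtain ⟨b, hb⟩ := e.support.bddAbove
  refine hm (b + 1) n (Finsupp.notMem_support_iff.1 fun hmem => ?_)
  have := hb hmem
  omega

/-- The operator `c t + f` on `S[t]`. -/
def shiftAdd (f : Module.End k S) (c : k) : Module.End k (ℕ →₀ S) :=
  Finsupp.mapRange.linearMap f + c • Finsupp.lmapDomain S k Nat.succ

theorem shiftAdd_single (f : Module.End k S) (c : k) (n : ℕ) (v : S) :
    shiftAdd f c (Finsupp.single n v) = Finsupp.single n (f v) + c • Finsupp.single (n + 1) v := by
  simp [shiftAdd, Finsupp.mapDomain_single]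

theorem shiftAdd_apply_succ (f : Module.End k S) (c : k) (e : ℕ →₀ S) (n : ℕ) :
    shiftAdd f c e (n + 1) = f (e (n + 1)) + c • e n := by
  simp [shiftAdd, ← Nat.succ_eq_add_one, Finsupp.mapDomain_apply Nat.succ_injective]

/-- Division by `c t + f` in `S[t]`. -/
theorem isDivision_finsupp (f : Module.End k S) {c : k} (hc : c ≠ 0) :
    IsDivision (Finsupp.lsingle 0 : S →ₗ[k] ℕ →₀ S) (shiftAdd f c) := by
  refine ⟨fun d => ?_, fun s e h => ?_⟩
  · have key : ∀ n v, Finsupp.single n v ∈ LinearMap.range (Finsupp.lsingle 0 : S →ₗ[k] ℕ →₀ S) ⊔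
        LinearMap.range (shiftAdd f c) := by
      intro n
      induction n with
      | zero => exact fun v => Submodule.mem_sup_left ⟨v, rfl⟩
      | succ n ih =>
        intro v
        -- Long division: `v t^(n+1) = c⁻¹((ct + f)(v t^n) - f(v) t^n)` lowers the degree in `t`
        -- modulo the image.
        have : Finsupp.single (n + 1) v = c⁻¹ •
            (shiftAdd f c (Finsupp.single n v) - Finsupp.single n (f v)) := by
          rw [shiftAdd_single, add_sub_cancel_left, inv_smul_smul₀ hc]
        rw [this]
        exact Submodule.smul_mem _ _
          (Submodule.sub_mem _ (Submodule.mem_sup_right ⟨_, rfl⟩) (ih _))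
    have hd : d ∈ LinearMap.range (Finsupp.lsingle 0 : S →ₗ[k] ℕ →₀ S) ⊔
        LinearMap.range (shiftAdd f c) := by
      induction d using Finsupp.induction_linear with
      | zero => exact Submodule.zero_mem _
      | add f g hf hg => exact Submodule.add_mem _ hf hg
      | single n v => exact key n v
    obtain ⟨_, ⟨s, rfl⟩, _, ⟨e, rfl⟩, rfl⟩ := Submodule.mem_sup.1 hd
    exact ⟨s, e, rfl⟩
  -- The remainder lives in degree 0, so every coefficient of positive degree of `(ct + f)e`
  -- vanishes, which says `c e_n = -f(e_(n+1))`.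
  · have he : e = 0 := by
      refine Finsupp.eq_zero_of_forall_succ e fun n hn => ?_
      have := DFunLike.congr_fun h (n + 1)
      rw [Finsupp.add_apply, shiftAdd_apply_succ, hn] at this
      simpa [hc] using this
    subst he
    simpa using h

/-- If `B = ⊕ₙ S ρⁿ`, then `B ⊗ M` admits division by `c (1 ⊗ f) - c' (ρ ⊗ 1)`. -/
theorem isDivision_tensor {i : S →ₗ[k] D} {ρ : Module.End k D} (ε : D ≃ₗ[k] ℕ →₀ S)
    (hi : ∀ s, ε (i s) = Finsupp.single 0 s)
    (hρ : ∀ b, ε (ρ b) = Finsupp.lmapDomain S k Nat.succ (ε b))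
    (f : Module.End k M) (c : k) {c' : k} (hc : c' ≠ 0) :
    IsDivision (i.rTensor M) (c • f.lTensor D - c' • ρ.rTensor M) := by
  classical
  let ε' : D ⊗[k] M ≃ₗ[k] ℕ →₀ S ⊗[k] M :=
    (TensorProduct.congr ε (LinearEquiv.refl k M)).trans (TensorProduct.finsuppLeft k k S M ℕ)
  have h := isDivision_finsupp (c • f.lTensor S) (neg_ne_zero.2 hc)
  have h1 : ∀ s, ε' (i.rTensor M s) = Finsupp.single 0 s := fun s => by
    induction s with
    | zero => simp
    | add s t hs ht => rw [map_add, map_add, hs, ht, Finsupp.single_add]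
    | tmul s m =>
      ext n
      simp only [ε', LinearMap.rTensor_tmul, LinearEquiv.trans_apply, TensorProduct.congr_tmul,
        LinearEquiv.refl_apply, hi, TensorProduct.finsuppLeft_apply_tmul_apply]
      rcases eq_or_ne n 0 with rfl | hn
      · simp
      · simp [Finsupp.single_eq_of_ne hn]
  have h2 : ∀ d, ε' ((c • f.lTensor D - c' • ρ.rTensor M) d) = shiftAdd (c • f.lTensor S) (-c') (ε' d) := fun d => by
    induction d with
    | zero => simp only [map_zero]
    | add s t hs ht => rw [map_add, map_add, hs, ht, map_add, map_add]
    | tmul b m =>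
      obtain ⟨b, rfl⟩ := ε.symm.surjective b
      induction b using Finsupp.induction_linear with
      | zero => simp only [map_zero, TensorProduct.zero_tmul]
      | add s t hs ht =>
        rw [map_add, TensorProduct.add_tmul, map_add, map_add, hs, ht, map_add, map_add]
      | single n s =>
        have e1 : ∀ m, ε' (ε.symm (Finsupp.single n s) ⊗ₜ m) = Finsupp.single n (s ⊗ₜ m) := by
          intro m
          simp [ε', TensorProduct.finsuppLeft_apply_tmul]
        have e2 : ε' (ρ (ε.symm (Finsupp.single n s)) ⊗ₜ m) = Finsupp.single (n + 1) (s ⊗ₜ m) := by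
          simp [ε', TensorProduct.finsuppLeft_apply_tmul, hρ, Finsupp.mapDomain_single]
        simp only [LinearMap.sub_apply, LinearMap.smul_apply, LinearMap.lTensor_tmul,
          LinearMap.rTensor_tmul, map_sub, map_smul, e1, e2, shiftAdd_single]
        simp [sub_eq_add_neg]
  refine ⟨fun d => ?_, fun s e hse => ?_⟩
  · obtain ⟨s, e, hd⟩ := h.exists_eq (ε' d)
    refine ⟨s, ε'.symm e, ε'.injective ?_⟩
    rw [map_add, h1, h2, hd, LinearEquiv.apply_symm_apply, Finsupp.lsingle_apply]
  · have := congrArg ε' hse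
    rw [map_add, h1, h2, map_zero] at this
    obtain ⟨hs, he⟩ := h.unique _ _ this
    exact ⟨hs, by simpa using he⟩

end Division

/-! ### Exactness of the horizontal complexes by elimination -/

section Elimination

variable {k : Type*} [Field k] {E E₁ E₂ E₃ : Type*} [AddCommGroup E] [Module k E]
  [AddCommGroup E₁] [Module k E₁] [AddCommGroup E₂] [Module k E₂] [AddCommGroup E₃] [Module k E₃]

/-- Exactness of the horizontal complex away from degree zero. -/
structure Ops.RowExact (O : Ops k E) (q : k) (a : k[X]) : Prop where
  eq_zero : ∀ e, O.d₃ q e = 0 → e = 0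
  exists_d₃ : ∀ v, O.d₂ q a v = 0 → ∃ e, O.d₃ q e = v
  exists_d₂ : ∀ v, O.d₁ v = 0 → ∃ w, O.d₂ q a w = v

/-- A flag `E₃ → E₂ → E₁ → E` along which one can divide successively by the operators of
`Y`, `X` and `H`. -/
structure Ops.Flag (O : Ops k E) (q : k) (j₁ : E₁ →ₗ[k] E) (j₂ : E₂ →ₗ[k] E₁)
    (j₃ : E₃ →ₗ[k] E₂) (lh₁ rh₁ lx₁ rx₁ : Module.End k E₁) (lh₂ rh₂ : Module.End k E₂) :
    Prop where
  lh₁_comm : ∀ e, O.lh (j₁ e) = j₁ (lh₁ e)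
  rh₁_comm : ∀ e, O.rh (j₁ e) = j₁ (rh₁ e)
  lx₁_comm : ∀ e, O.lx (j₁ e) = j₁ (lx₁ e)
  rx₁_comm : ∀ e, O.rx (j₁ e) = j₁ (rx₁ e)
  lh₂_comm : ∀ e, lh₁ (j₂ e) = j₂ (lh₂ e)
  rh₂_comm : ∀ e, rh₁ (j₂ e) = j₂ (rh₂ e)
  divY : IsDivision j₁ (O.ly - O.ry)
  divYq : IsDivision j₁ (O.ly - q • O.ry)
  divX : IsDivision j₂ (lx₁ - rx₁)
  divXq : IsDivision j₂ (q • lx₁ - rx₁)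
  divH : IsDivision j₃ (lh₂ - rh₂)

namespace Ops.Flag

variable {O : Ops k E} {q : k} {a : k[X]} {j₁ : E₁ →ₗ[k] E} {j₂ : E₂ →ₗ[k] E₁}
    {j₃ : E₃ →ₗ[k] E₂} {lh₁ rh₁ lx₁ rx₁ : Module.End k E₁} {lh₂ rh₂ : Module.End k E₂}
    (h : O.Flag q j₁ j₂ j₃ lh₁ rh₁ lx₁ rx₁ lh₂ rh₂)
include h

/-- Three successive divisions: modulo boundaries every element comes from the bottom of the flag,
which bounds the degree 0 homology by `E₃`. -/
theorem exists_eq (e : E) : ∃ m v, e = j₁ (j₂ (j₃ m)) + O.d₁ v := by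
  obtain ⟨e₁, f, rfl⟩ := h.divY.exists_eq e
  obtain ⟨e₂, g, rfl⟩ := h.divX.exists_eq e₁
  obtain ⟨m, t, rfl⟩ := h.divH.exists_eq e₂
  refine ⟨m, (f, j₁ (j₂ t), j₁ g), ?_⟩
  simp only [Ops.d₁_apply, h.lh₁_comm, h.rh₁_comm, h.lx₁_comm, h.rx₁_comm, h.lh₂_comm, h.rh₂_comm, map_add, map_sub,
    LinearMap.sub_apply]
  abel

/-- Gaussian elimination. Boundaries are subtracted until the relevant coordinates of a cycle are
remainders lying in smaller steps of the flag; the cycle equation, read as a division of zero, then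
forces everything to vanish by uniqueness. -/
theorem rowExact (hO : O.IsSmith q a) : O.RowExact q a := by
  have h₃ : ∀ e, O.d₃ q e = 0 → e = 0 := fun e he => by
    rw [Ops.d₃_apply] at he
    exact h.divYq.injective (congrArg Prod.fst he)
  refine ⟨h₃, fun v hv => ?_, fun v hv => ?_⟩
  · obtain ⟨p, w, hw⟩ := h.divYq.exists_eq v.1
    refine ⟨w, (sub_eq_zero.1 (?_ : v - O.d₃ q w = 0)).symm⟩
    -- Once the `H ∧ X` coordinate is a remainder `j₁ p`, the `X` component of `d₂` kills the `Y ∧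
    -- X` coordinate, and the `H` component then kills the `Y ∧ H` coordinate and `p`.
    have hz : O.d₂ q a (v - O.d₃ q w) = 0 := by rw [map_sub, hv, hO.d₂_d₃, sub_zero]
    have hp : (v - O.d₃ q w).1 = j₁ p := by
      rw [Prod.fst_sub, hw, Ops.d₃_apply]
      exact add_sub_cancel_right _ _
    generalize v - O.d₃ q w = z at hz hp
    obtain ⟨P, Q, R⟩ := z
    obtain rfl : P = j₁ p := hp
    rw [Ops.d₂_apply, Prod.mk_eq_zero, Prod.mk_eq_zero, h.lh₁_comm, h.rh₁_comm, h.lx₁_comm, h.rx₁_comm] at hz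
    obtain ⟨-, hH, hX⟩ := hz
    obtain ⟨-, rfl⟩ := h.divY.unique (lh₁ p - q • rh₁ p) Q (by
      rw [map_sub, map_smul]; exact hX)
    obtain ⟨hp, rfl⟩ := h.divYq.unique (-(q • lx₁ p - rx₁ p)) R (by
      rw [map_neg, map_sub, map_smul]; simpa using hH)
    rw [neg_eq_zero] at hp
    rw [h.divXq.injective (e := p) hp, map_zero]
    rfl
  · obtain ⟨f, g, e⟩ := v
    -- `Q` reduces the `X` coordinate by `Y`. `R` and `p` reduce the `H` coordinate by `Y` and then
    -- by `X`, after removing the effect of `Q`. The sign in `-j₁ p` matches the entry `-(q • lx -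
    -- rx)` of `d₂`; the change `-j₁ p` causes in the `X` coordinate stays in the image of `j₁`,
    -- hence is harmless.
    obtain ⟨s, Q, rfl⟩ := h.divY.exists_eq e
    obtain ⟨r, R, hR⟩ := h.divYq.exists_eq (g - (O.d₂ q a (0, Q, 0)).2.1)
    obtain ⟨t, p, rfl⟩ := h.divXq.exists_eq r
    refine ⟨(-j₁ p, Q, R), (sub_eq_zero.1 (?_ : (f, g, _) - O.d₂ q a (-j₁ p, Q, R) = 0)).symm⟩
    have hz : O.d₁ ((f, g, j₁ s + (O.ly - O.ry) Q) - O.d₂ q a (-j₁ p, Q, R)) = 0 := by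
      rw [map_sub, hv, hO.d₁_d₂, sub_zero]
    have hg : g = (O.d₂ q a (0, Q, 0)).2.1 + (j₁ (j₂ t + (q • lx₁ - rx₁) p)
        + (O.ly - q • O.ry) R) := by rw [← hR]; abel
    have e1 : ((f, g, j₁ s + (O.ly - O.ry) Q) - O.d₂ q a (-j₁ p, Q, R)).2.1 = j₁ (j₂ t) := by
      rw [Prod.snd_sub, Prod.fst_sub, hg]
      simp only [Ops.d₂_apply, map_neg, map_zero, h.lx₁_comm, h.rx₁_comm, map_add, LinearMap.sub_apply,
        LinearMap.smul_apply, map_sub, map_smul]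
      module
    have e2 : ((f, g, j₁ s + (O.ly - O.ry) Q) - O.d₂ q a (-j₁ p, Q, R)).2.2
        = j₁ (s + lh₁ p - q • rh₁ p) := by
      rw [Prod.snd_sub, Prod.snd_sub]
      simp only [Ops.d₂_apply, map_neg, h.lh₁_comm, h.rh₁_comm, map_add, LinearMap.sub_apply,
        map_sub, map_smul]
      module
    generalize (f, g, j₁ s + (O.ly - O.ry) Q) - O.d₂ q a (-j₁ p, Q, R) = z at hz e1 e2
    generalize s + lh₁ p - q • rh₁ p = s at e2
    obtain ⟨f, g, e⟩ := z
    obtain rfl : g = j₁ (j₂ t) := e1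
    obtain rfl : e = j₁ s := e2
    rw [Ops.d₁_apply, h.lh₁_comm, h.rh₁_comm, h.lx₁_comm, h.rx₁_comm, h.lh₂_comm, h.rh₂_comm] at hz
    obtain ⟨hs, rfl⟩ := h.divY.unique (j₂ ((lh₂ - rh₂) t) + (lx₁ - rx₁) s) f (by
      rw [add_comm]
      simpa using hz)
    obtain ⟨ht, rfl⟩ := h.divX.unique _ _ hs
    rw [h.divH.injective ht]
    simp

end Ops.Flag

end Elimination

/-! ### Reduction modulo a regular Casimir element -/

section Reduction

variable {k : Type*} [Field k] {E E' : Type*} [AddCommGroup E] [Module k E]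
  [AddCommGroup E'] [Module k E']

/-- A linear map intertwining two sextuples of operators. -/
structure Ops.Intertwines (O : Ops k E) (O' : Ops k E') (φ : E →ₗ[k] E') : Prop where
  ly : ∀ e, φ (O.ly e) = O'.ly (φ e)
  lh : ∀ e, φ (O.lh e) = O'.lh (φ e)
  lx : ∀ e, φ (O.lx e) = O'.lx (φ e)
  ry : ∀ e, φ (O.ry e) = O'.ry (φ e)
  rh : ∀ e, φ (O.rh e) = O'.rh (φ e)
  rx : ∀ e, φ (O.rx e) = O'.rx (φ e)

theorem map_divDiff {φ : E →ₗ[k] E'} (a : k[X]) {u v : Module.End k E} {u' v' : Module.End k E'}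
    (hu : ∀ e, φ (u e) = u' (φ e)) (hv : ∀ e, φ (v e) = v' (φ e)) (e : E) :
    φ (divDiff a u v e) = divDiff a u' v' (φ e) := by
  have hpow : ∀ {u : Module.End k E} {u' : Module.End k E'}, (∀ e, φ (u e) = u' (φ e)) →
      ∀ n e, φ ((u ^ n) e) = (u' ^ n) (φ e) := by
    intro u u' hu n
    induction n with
    | zero => simp
    | succ n ih => intro e; rw [pow_succ', pow_succ', Module.End.mul_apply, hu, ih]; rfl
  simp [divDiff, hpow hu, hpow hv]

namespace Ops.Intertwines

variable {O : Ops k E} {O' : Ops k E'} {φ : E →ₗ[k] E'} (h : O.Intertwines O' φ)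
include h

theorem diff (a : k[X]) (c f : k) (e : E) : φ (O.diff a c f e) = O'.diff a c f (φ e) :=
  map_divDiff a (fun e => by simp [h.rh]) (fun e => by simp [h.lh]) e

theorem d₁ (v : E × E × E) : φ (O.d₁ v) = O'.d₁ (φ.prodMap (φ.prodMap φ) v) := by
  obtain ⟨f, g, e⟩ := v
  simp [Ops.d₁_apply, h.ly, h.lh, h.lx, h.ry, h.rh, h.rx]

theorem d₂ (q : k) (a : k[X]) (v : E × E × E) :
    φ.prodMap (φ.prodMap φ) (O.d₂ q a v) = O'.d₂ q a (φ.prodMap (φ.prodMap φ) v) := by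
  obtain ⟨f, g, e⟩ := v
  simp [Ops.d₂_apply, h.ly, h.lh, h.lx, h.ry, h.rh, h.rx, h.diff]

theorem d₃ (q : k) (e : E) : φ.prodMap (φ.prodMap φ) (O.d₃ q e) = O'.d₃ q (φ e) := by
  simp [Ops.d₃_apply, h.ly, h.lh, h.lx, h.ry, h.rh, h.rx]

theorem δ₀ (a : k[X]) (e : E) : φ.prodMap (φ.prodMap φ) (O.δ₀ a e) = O'.δ₀ a (φ e) := by
  simp [Ops.δ₀_apply, h.lx, h.ry, h.diff]

end Ops.Intertwines

theorem Ops.IsSmith.casimir_intertwines {O : Ops k E} {q : k} {a : k[X]} (hO : O.IsSmith q a) :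
    O.Intertwines O (O.casimir a) := by
  -- Right multiplications compose in the opposite order, so `rx` and `ry` exchange the roles of `Y`
  -- and `X`.
  have h := commute_casimir a (Y := O.rx) (H := O.rh) (X := O.ry) hO.rh_rx hO.ry_rh hO.ry_rx
  have hl : ∀ z : Module.End k E, Commute O.ry z → Commute O.rh z → Commute O.rx z →
      Commute (O.casimir a) z := fun z h1 h2 h3 =>
    (h3.mul_left h1).sub_left (mul_aeval_of_mul_eq h2.symm.eq a).symm
  exact ⟨LinearMap.congr_fun (hl _ hO.ry_ly hO.rh_ly hO.rx_ly),
    LinearMap.congr_fun (hl _ hO.ry_lh hO.rh_lh hO.rx_lh),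
    LinearMap.congr_fun (hl _ hO.ry_lx hO.rh_lx hO.rx_lx),
    LinearMap.congr_fun h.2.2, LinearMap.congr_fun h.2.1, LinearMap.congr_fun h.1⟩

/-- The homology of the horizontal complexes after reduction modulo the Casimir element:
it vanishes above degree one, and in degree one it is generated freely by the image of `δ₀`. -/
structure Ops.RowHomology (O : Ops k E) (q : k) (a : k[X]) : Prop where
  eq_zero : ∀ e, O.d₃ q e = 0 → e = 0
  exists_d₃ : ∀ v, O.d₂ q a v = 0 → ∃ e, O.d₃ q e = v
  exists_d₂_add_δ₀ : ∀ v, O.d₁ v = 0 → ∃ w e, O.d₂ q a w + O.δ₀ a e = v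
  exists_d₁ : ∀ e w, O.δ₀ a e = O.d₂ q a w → ∃ v, O.d₁ v = e

/-- The long exact homology sequence of `0 → E → E → E' → 0` with first map the Casimir operator,
written as a chase. The connecting map from degree 1 to degree 0 is inverted, up to sign, by `δ₀`,
because of `d₁_δ₀`. -/
theorem Ops.RowExact.reduce {O : Ops k E} {O' : Ops k E'} {q : k} {a : k[X]}
    (h : O.RowExact q a) (hO : O.IsSmith q a) {φ : E →ₗ[k] E'} (hφ : O.Intertwines O' φ)
    (hsurj : Function.Surjective φ) (hker : ∀ e, φ e = 0 → ∃ w, O.casimir a w = e)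
    (hφcas : ∀ e, φ (O.casimir a e) = 0)
    (hinj : ∀ e, O.casimir a e = 0 → e = 0) : O'.RowHomology q a := by
  have hΩ := hO.casimir_intertwines
  have hφ0 := hφcas
  have hΩ3 : ∀ v : E × E × E, (O.casimir a).prodMap ((O.casimir a).prodMap (O.casimir a)) v = 0 →
      v = 0 := by
    rintro ⟨f, g, e⟩ hv
    simp only [LinearMap.prodMap_apply, Prod.mk_eq_zero] at hv
    rw [hinj _ hv.1, hinj _ hv.2.1, hinj _ hv.2.2]
    rfl
  have hsurj3 : Function.Surjective (φ.prodMap (φ.prodMap φ)) := by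
    rintro ⟨f, g, e⟩
    obtain ⟨f, rfl⟩ := hsurj f
    obtain ⟨g, rfl⟩ := hsurj g
    obtain ⟨e, rfl⟩ := hsurj e
    exact ⟨(f, g, e), rfl⟩
  have hker3 : ∀ v, φ.prodMap (φ.prodMap φ) v = 0 →
      ∃ w, (O.casimir a).prodMap ((O.casimir a).prodMap (O.casimir a)) w = v := by
    rintro ⟨f, g, e⟩ hv
    simp only [LinearMap.prodMap_apply, Prod.mk_eq_zero] at hv
    obtain ⟨f, rfl⟩ := hker _ hv.1
    obtain ⟨g, rfl⟩ := hker _ hv.2.1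
    obtain ⟨e, rfl⟩ := hker _ hv.2.2
    exact ⟨(f, g, e), rfl⟩
  have hφ3 : ∀ v, φ.prodMap (φ.prodMap φ)
      ((O.casimir a).prodMap ((O.casimir a).prodMap (O.casimir a)) v) = 0 := by
    rintro ⟨f, g, e⟩
    simp [hφ0]
  refine ⟨fun e he => ?_, fun v hv => ?_, fun v hv => ?_, fun e w hew => ?_⟩
  · obtain ⟨e, rfl⟩ := hsurj e
    rw [← hφ.d₃] at he
    obtain ⟨w, hw⟩ := hker3 _ he
    have hw' : O.d₂ q a w = 0 := hΩ3 _ (by rw [hΩ.d₂, hw, hO.d₂_d₃])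
    obtain ⟨u, rfl⟩ := h.exists_d₃ w hw'
    rw [hΩ.d₃] at hw
    rw [sub_eq_zero.1 (h.eq_zero (e - O.casimir a u) (by rw [map_sub, hw, sub_self])), hφ0]
  · obtain ⟨v, rfl⟩ := hsurj3 v
    rw [← hφ.d₂] at hv
    obtain ⟨w, hw⟩ := hker3 _ hv
    have hw' : O.d₁ w = 0 := hinj _ (by rw [hΩ.d₁, hw, hO.d₁_d₂])
    obtain ⟨u, rfl⟩ := h.exists_d₂ w hw'
    rw [hΩ.d₂] at hw
    obtain ⟨e, he⟩ := h.exists_d₃ _ ((by rw [map_sub, hw, sub_self] :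
      O.d₂ q a (v - (O.casimir a).prodMap ((O.casimir a).prodMap (O.casimir a)) u) = 0))
    exact ⟨φ e, by rw [← hφ.d₃, he, map_sub, hφ3, sub_zero]⟩
  · obtain ⟨v, rfl⟩ := hsurj3 v
    rw [← hφ.d₁] at hv
    obtain ⟨w, hw⟩ := hker _ hv
    -- The lifted cycle has boundary `Ωw`, which is exactly cancelled by the boundary of `δ₀ w`.
    obtain ⟨u, hu⟩ := h.exists_d₂ (v + O.δ₀ a w) (by
      rw [map_add, hO.d₁_δ₀, hw, add_neg_cancel])
    refine ⟨φ.prodMap (φ.prodMap φ) u, -φ w, ?_⟩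
    rw [← hφ.d₂, hu, map_add, hφ.δ₀, map_neg, add_neg_cancel_right]
  · obtain ⟨e, rfl⟩ := hsurj e
    obtain ⟨w, rfl⟩ := hsurj3 w
    obtain ⟨u, hu⟩ := hker3 (O.δ₀ a e - O.d₂ q a w) (by rw [map_sub, hφ.δ₀, hφ.d₂, hew, sub_self])
    -- Taking boundaries turns the equation into `Ω(d₁ u) = -Ωe`, and `Ω` can be cancelled.
    have := congrArg O.d₁ hu
    rw [← hΩ.d₁, map_sub, hO.d₁_δ₀, hO.d₁_d₂, sub_zero] at this
    have he : O.d₁ u + e = 0 := hinj _ (by rw [map_add, this, neg_add_cancel])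
    refine ⟨-φ.prodMap (φ.prodMap φ) u, ?_⟩
    rw [map_neg, ← hφ.d₁, ← map_neg, neg_eq_of_add_eq_zero_right he]

end Reduction

/-! ### The right regular representation of the Smith algebra on ordered monomials -/

section Fock

variable {k : Type u} [Field k]

/-- The vector space with basis the ordered monomials `H ^ j X ^ i`. -/
def FockR (k : Type u) [Field k] : Type u := ℕ →₀ k[X]

instance : AddCommGroup (FockR k) := inferInstanceAs (AddCommGroup (ℕ →₀ k[X]))

instance : Module k (FockR k) := inferInstanceAs (Module k (ℕ →₀ k[X]))

/-- The element `p(H) X ^ i`. -/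
def FockR.single (i : ℕ) : k[X] →ₗ[k] FockR k := (Finsupp.lsingle i : k[X] →ₗ[k] ℕ →₀ k[X])

/-- The coefficient of `X ^ i`. -/
def FockR.coeff (i : ℕ) : FockR k →ₗ[k] k[X] := (Finsupp.lapply i : (ℕ →₀ k[X]) →ₗ[k] k[X])

/-- The linear map with prescribed values on the elements `p(H) X ^ i`. -/
def FockR.lift {N : Type*} [AddCommGroup N] [Module k N] (L : ℕ → k[X] →ₗ[k] N) :
    FockR k →ₗ[k] N :=
  (Finsupp.lsum k L : (ℕ →₀ k[X]) →ₗ[k] N)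

theorem FockR.lift_single {N : Type*} [AddCommGroup N] [Module k N] (L : ℕ → k[X] →ₗ[k] N)
    (i : ℕ) (p : k[X]) : FockR.lift L (FockR.single i p) = L i p :=
  Finsupp.lsum_single k L i p

theorem FockR.coeff_single (i j : ℕ) (p : k[X]) :
    FockR.coeff i (FockR.single j p) = if j = i then p else 0 :=
  Finsupp.single_apply

theorem FockR.ext {f g : FockR k} (h : ∀ i, FockR.coeff i f = FockR.coeff i g) : f = g :=
  Finsupp.ext h

theorem FockR.hom_ext {N : Type*} [AddCommGroup N] [Module k N] {f g : FockR k →ₗ[k] N}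
    (h : ∀ i p, f (FockR.single i p) = g (FockR.single i p)) : f = g :=
  Finsupp.lhom_ext' (φ := (f : (ℕ →₀ k[X]) →ₗ[k] N)) (ψ := (g : (ℕ →₀ k[X]) →ₗ[k] N))
    fun i => LinearMap.ext (h i)

/-- The vector space with basis the ordered monomials `H ^ j X ^ i Y ^ n`. -/
abbrev Fock (k : Type u) [Field k] : Type u := ℕ →₀ FockR k

/-- The element `p(H) X ^ i Y ^ n`. -/
abbrev mon (n i : ℕ) (p : k[X]) : Fock k := Finsupp.single n (FockR.single i p)

theorem mon_add (n i : ℕ) (p r : k[X]) : mon n i (p + r) = mon n i p + mon n i r := by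
  simp [mon]

theorem mon_sub (n i : ℕ) (p r : k[X]) : mon n i (p - r) = mon n i p - mon n i r := by
  simp [mon]

theorem smul_mon (n i : ℕ) (c : k) (p : k[X]) : c • mon n i p = mon n i (c • p) := by
  simp [mon]

/-- The polynomial `b(cH)`. -/
abbrev dilate (c : k) (b : k[X]) : k[X] := b.comp (Polynomial.C c * Polynomial.X)

theorem dilate_dilate (c e : k) (b : k[X]) : dilate c (dilate e b) = dilate (e * c) b := by
  simp [dilate, Polynomial.comp_assoc, mul_assoc]

/-- The linear map with prescribed values on the elements `p(H) X ^ i Y ^ n`. -/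
def Fock.lift {N : Type*} [AddCommGroup N] [Module k N] (L : ℕ → ℕ → k[X] →ₗ[k] N) :
    Fock k →ₗ[k] N :=
  Finsupp.lsum k fun n => FockR.lift (L n)

theorem Fock.lift_mon {N : Type*} [AddCommGroup N] [Module k N] (L : ℕ → ℕ → k[X] →ₗ[k] N)
    (n i : ℕ) (p : k[X]) : Fock.lift L (mon n i p) = L n i p := by
  rw [Fock.lift, mon, Finsupp.lsum_single, FockR.lift_single]

theorem Fock.hom_ext {N : Type*} [AddCommGroup N] [Module k N] {f g : Fock k →ₗ[k] N}
    (h : ∀ n i p, f (mon n i p) = g (mon n i p)) : f = g :=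
  Finsupp.lhom_ext' fun n => FockR.hom_ext (h n)

variable (q : k) (a : k[X])

/-- Right multiplication by `Y`. -/
def fockY : Module.End k (Fock k) := Finsupp.lmapDomain _ k Nat.succ

/-- Right multiplication by `H`. -/
def fockH : Module.End k (Fock k) :=
  Fock.lift fun n i => Finsupp.lsingle n ∘ₗ FockR.single i ∘ₗ
    LinearMap.mulLeft k (Polynomial.C (q ^ i * q⁻¹ ^ n) * Polynomial.X)

/-- The map `p(H) ↦ p(H) X ^ i (Y ^ n X - X Y ^ n)`. -/
def fockBracket (i : ℕ) : ℕ → k[X] →ₗ[k] Fock k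
  | 0 => 0
  | n + 1 => Finsupp.lsingle n ∘ₗ FockR.single i ∘ₗ
      LinearMap.mulLeft k (dilate (q ^ i * q⁻¹ ^ n) a - dilate (q ^ i * q) a)

/-- Right multiplication by `X`. -/
def fockX : Module.End k (Fock k) :=
  Fock.lift (k := k) (N := Fock k) fun n i =>
    Finsupp.lsingle n ∘ₗ FockR.single (i + 1) + fockBracket q a i n

theorem fockY_mon (n i : ℕ) (p : k[X]) : fockY (mon n i p) = mon (n + 1) i p := by
  simp [fockY, Finsupp.mapDomain_single]

theorem fockH_mon (n i : ℕ) (p : k[X]) :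
    fockH q (mon n i p) = mon n i (Polynomial.C (q ^ i * q⁻¹ ^ n) * Polynomial.X * p) := by
  rw [fockH, Fock.lift_mon]
  rfl

theorem fockX_mon_zero (i : ℕ) (p : k[X]) : fockX q a (mon 0 i p) = mon 0 (i + 1) p := by
  rw [fockX, Fock.lift_mon]
  simp [fockBracket]

/-- The correction term is forced by `B`: `Y^(n+1) X = Y^n Ω + Y^n a(H)` and `X Y^(n+1) = Ω Y^n +
a(qH) Y^n` give `Y^(n+1) X - X Y^(n+1) = (a(q⁻ⁿH) - a(qH)) Y^n`, and moving `X^i` past it rescales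
`H` by `q^i`. -/
theorem fockX_mon_succ (n i : ℕ) (p : k[X]) :
    fockX q a (mon (n + 1) i p) = mon (n + 1) (i + 1) p
      + mon n i ((dilate (q ^ i * q⁻¹ ^ n) a - dilate (q ^ i * q) a) * p) := by
  rw [fockX, Fock.lift_mon]
  rfl

theorem aeval_fockH_mon (b : k[X]) (n i : ℕ) (p : k[X]) :
    Polynomial.aeval (fockH q) b (mon n i p) = mon n i (dilate (q ^ i * q⁻¹ ^ n) b * p) := by
  induction b using Polynomial.induction_on generalizing p with
  | C c => simp [Polynomial.C_mul', Module.algebraMap_end_apply, mon]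
  | add b c hb hc =>
    simp only [map_add, LinearMap.add_apply, hb, hc, dilate, Polynomial.add_comp, add_mul,
      mon_add]
  | monomial m c ih =>
    rw [pow_succ, ← mul_assoc, map_mul, Polynomial.aeval_X, Module.End.mul_apply, fockH_mon, ih]
    simp [dilate, mul_assoc]

variable {q} (hq : q ≠ 0)
include hq

theorem mul_pow_mul_inv_pow_succ (i n : ℕ) : q * (q ^ i * q⁻¹ ^ (n + 1)) = q ^ i * q⁻¹ ^ n := by
  rw [pow_succ q⁻¹, mul_left_comm, mul_comm _ q⁻¹, mul_inv_cancel_left₀ hq]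

theorem fock_rh_rx : fockH q * fockX q a = q • (fockX q a * fockH q) := by
  refine Fock.hom_ext fun n i p => ?_
  cases n with
  | zero =>
    simp only [Module.End.mul_apply, LinearMap.smul_apply, fockX_mon_zero, fockH_mon,
      smul_mon]
    congr 2
    simp [Polynomial.smul_eq_C_mul, pow_succ]
    ring
  | succ n =>
    simp only [Module.End.mul_apply, LinearMap.smul_apply, fockX_mon_succ, fockH_mon, map_add,
      smul_mon, smul_add]
    congr 3
    · simp [Polynomial.smul_eq_C_mul, pow_succ]
      ring
    · have : Polynomial.C (q ^ i * q⁻¹ ^ n)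
          = Polynomial.C q * Polynomial.C (q ^ i * q⁻¹ ^ (n + 1)) := by
        rw [← Polynomial.C_mul, mul_pow_mul_inv_pow_succ hq]
      rw [this, Polynomial.smul_eq_C_mul]
      ring

theorem fock_ry_rh : fockY * fockH q = q • (fockH q * fockY) := by
  refine Fock.hom_ext fun n i p => ?_
  simp only [Module.End.mul_apply, LinearMap.smul_apply, fockY_mon, fockH_mon,
    smul_mon]
  have : Polynomial.C (q ^ i * q⁻¹ ^ n)
      = Polynomial.C q * Polynomial.C (q ^ i * q⁻¹ ^ (n + 1)) := by
    rw [← Polynomial.C_mul, mul_pow_mul_inv_pow_succ hq]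
  rw [this, Polynomial.smul_eq_C_mul, mul_assoc, mul_assoc, mul_assoc]

theorem fock_ry_rx : fockY * fockX q a - fockX q a * fockY
    = Polynomial.aeval (q • fockH q) a - Polynomial.aeval (fockH q) a := by
  rw [aeval_smul]
  refine Fock.hom_ext fun n i p => ?_
  simp only [Module.End.mul_apply, LinearMap.sub_apply, fockY_mon, aeval_fockH_mon,
    fockX_mon_succ, dilate_dilate]
  cases n with
  | zero =>
    rw [fockX_mon_zero, fockY_mon, sub_add_cancel_left, sub_mul, mon_sub, neg_sub, pow_zero,
      mul_one, mul_comm q]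
  | succ n =>
    rw [fockX_mon_succ, map_add, fockY_mon, fockY_mon, add_sub_add_left_eq_sub, ← mon_sub,
      ← mon_sub, ← sub_mul, ← sub_mul, sub_sub_sub_cancel_right,
      mul_pow_mul_inv_pow_succ hq]

omit hq in
variable (q) in
/-- Right multiplication by `Ω`. -/
def fockOmega : Module.End k (Fock k) := fockX q a * fockY - Polynomial.aeval (fockH q) a

omit hq in
-- The two `a(q^i q⁻ⁿ H)` terms cancel, so `Ω` acts as the diagonal shift `(n, i) ↦ (n+1, i+1)`
-- minus a multiplication operator.
theorem fockOmega_mon (n i : ℕ) (p : k[X]) :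
    fockOmega q a (mon n i p)
      = mon (n + 1) (i + 1) p - mon n i (dilate (q ^ i * q) a * p) := by
  rw [fockOmega, LinearMap.sub_apply, Module.End.mul_apply, fockY_mon, aeval_fockH_mon,
    fockX_mon_succ, sub_mul, mon_sub, add_sub_assoc, sub_sub_cancel_left, ← sub_eq_add_neg]

omit hq in
theorem fockOmega_apply (f : Fock k) (n i : ℕ) :
    FockR.coeff (i + 1) (fockOmega q a f (n + 1)) = FockR.coeff i (f n)
      - dilate (q ^ (i + 1) * q) a * FockR.coeff (i + 1) (f (n + 1)) := by
  have hext : (FockR.coeff (i + 1) ∘ₗ Finsupp.lapply (n + 1) ∘ₗ fockOmega q a : Fock k →ₗ[k] k[X])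
      = FockR.coeff i ∘ₗ Finsupp.lapply n - LinearMap.mulLeft k (dilate (q ^ (i + 1) * q) a) ∘ₗ
        FockR.coeff (i + 1) ∘ₗ Finsupp.lapply (n + 1) := by
    refine Fock.hom_ext fun m j p => ?_
    rw [LinearMap.comp_apply, LinearMap.comp_apply, fockOmega_mon]
    simp only [LinearMap.comp_apply, map_sub, Finsupp.lapply_apply, mon,
      LinearMap.sub_apply, LinearMap.mulLeft_apply, Finsupp.single_apply,
      Nat.add_right_cancel_iff]
    have h1 : FockR.coeff (i + 1) (if m = n then FockR.single (j + 1) p else 0)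
        = FockR.coeff i (if m = n then FockR.single j p else 0) := by
      split_ifs
      · simp only [FockR.coeff_single, Nat.add_right_cancel_iff]
      · simp only [map_zero]
    have h2 : FockR.coeff (i + 1)
        (if m = n + 1 then FockR.single j (dilate (q ^ j * q) a * p) else 0)
        = dilate (q ^ (i + 1) * q) a *
          FockR.coeff (i + 1) (if m = n + 1 then FockR.single j p else 0) := by
      split_ifs
      · simp only [FockR.coeff_single]
        split_ifs with h
        · rw [h]
        · rw [mul_zero]
      · rw [map_zero, mul_zero]
    rw [h1, h2]
  exact LinearMap.congr_fun hext f

omit hq in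
-- If `Ωf = 0`, the coefficient of `X^(i+1) Y^(n+1)` expresses that of `X^i Y^n` in `f` through the
-- next one on the diagonal; finite support makes all of them zero.
theorem fockOmega_injective : Function.Injective (fockOmega q a) := by
  rw [← LinearMap.ker_eq_bot, LinearMap.ker_eq_bot']
  intro f hf
  refine Finsupp.eq_zero_of_forall_succ f fun n hn => FockR.ext fun i => ?_
  have := fockOmega_apply (q := q) a f n i
  rw [hf, hn] at this
  simpa using this.symm

/-! ### Comparison of the model with the Smith algebra -/

/-- The right action of the Smith algebra on the model. -/
def fockAction : Smith q (smithPoly q a) →ₐ[k] (Module.End k (Fock k))ᵐᵒᵖ :=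
  Smith.lift ![MulOpposite.op fockY, MulOpposite.op (fockH q), MulOpposite.op (fockX q a)]
    (by
      change MulOpposite.op _ * MulOpposite.op _ = q • (MulOpposite.op _ * MulOpposite.op _)
      rw [← MulOpposite.op_mul, fock_ry_rh hq]
      rfl)
    (by
      change MulOpposite.op _ * MulOpposite.op _ - MulOpposite.op _ * MulOpposite.op _
        = Polynomial.aeval (MulOpposite.op _) _
      rw [← MulOpposite.op_mul, ← MulOpposite.op_mul, ← MulOpposite.op_sub, fock_ry_rx a hq,
        Polynomial.aeval_op_apply, aeval_smithPoly])
    (by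
      change MulOpposite.op _ * MulOpposite.op _ = q • (MulOpposite.op _ * MulOpposite.op _)
      rw [← MulOpposite.op_mul, fock_rh_rx a hq]
      rfl)

theorem fockAction_gen (i : Fin 3) :
    fockAction a hq (Smith.gen q (smithPoly q a) i)
      = ![MulOpposite.op fockY, MulOpposite.op (fockH q), MulOpposite.op (fockX q a)] i :=
  Smith.lift_gen _ _ _ _ i

omit hq in
variable (q) in
/-- The map `p(H) X ^ i Y ^ n ↦ p(H) X ^ i Y ^ n` from the model to the Smith algebra. -/
def fockToSmith : Fock k →ₗ[k] Smith q (smithPoly q a) :=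
  Fock.lift fun n i => LinearMap.mulRight k (Smith.gen q _ 2 ^ i * Smith.gen q _ 0 ^ n) ∘ₗ
    (Polynomial.aeval (Smith.gen q (smithPoly q a) 1)).toLinearMap

omit hq in
theorem fockToSmith_mon (n i : ℕ) (p : k[X]) :
    fockToSmith q a (mon n i p) = Polynomial.aeval (Smith.gen q (smithPoly q a) 1) p *
      (Smith.gen q _ 2 ^ i * Smith.gen q _ 0 ^ n) := by
  rw [fockToSmith, Fock.lift_mon]
  rfl

/-- Acting on the vacuum `1` with the element attached to `f` returns `f`. This is the linear
independence half of the PBW theorem for `B`. -/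
theorem fockAction_fockToSmith (f : Fock k) :
    (fockAction a hq (fockToSmith q a f)).unop (mon 0 0 1) = f := by
  have hY : ∀ n i (p : k[X]), (fockY ^ n) (mon 0 i p) = mon n i p := fun n i p => by
    induction n with
    | zero => rfl
    | succ n ih => rw [pow_succ', Module.End.mul_apply, ih, fockY_mon]
  have hX : ∀ i (p : k[X]), (fockX q a ^ i) (mon 0 0 p) = mon 0 i p := fun i p => by
    induction i with
    | zero => rfl
    | succ n ih => rw [pow_succ', Module.End.mul_apply, ih, fockX_mon_zero]
  have hext : (LinearMap.applyₗ (mon 0 0 1) ∘ₗ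
      (MulOpposite.opLinearEquiv k (M := Module.End k (Fock k))).symm.toLinearMap ∘ₗ
      (fockAction a hq).toLinearMap ∘ₗ fockToSmith q a : Fock k →ₗ[k] Fock k)
        = LinearMap.id := by
    refine Fock.hom_ext fun n i p => ?_
    change (fockAction a hq (fockToSmith q a (mon n i p))).unop (mon 0 0 1) = mon n i p
    rw [fockToSmith_mon, map_mul, map_mul, map_pow, map_pow, ← Polynomial.aeval_algHom_apply]
    simp only [fockAction_gen]
    change ((MulOpposite.op _ : (Module.End k (Fock k))ᵐᵒᵖ) ^ n).unop
      (((MulOpposite.op _ : (Module.End k (Fock k))ᵐᵒᵖ) ^ i).unop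
        ((Polynomial.aeval (MulOpposite.op (fockH q)) p :
          (Module.End k (Fock k))ᵐᵒᵖ).unop _)) = _
    rw [Polynomial.aeval_op_apply, ← MulOpposite.op_pow, ← MulOpposite.op_pow,
      MulOpposite.unop_op, MulOpposite.unop_op, MulOpposite.unop_op, aeval_fockH_mon, hX, hY]
    simp [dilate]
  exact LinearMap.congr_fun hext f

theorem fockToSmith_injective : Function.Injective (fockToSmith q a) :=
  Function.LeftInverse.injective
    (g := fun b => (fockAction a hq b).unop (mon 0 0 1)) (fockAction_fockToSmith a hq)

omit hq in
theorem fockToSmith_fockY (f : Fock k) :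
    fockToSmith q a (fockY f) = fockToSmith q a f * Smith.gen q _ 0 := by
  refine LinearMap.congr_fun (Fock.hom_ext
    (f := fockToSmith q a ∘ₗ fockY) (g := LinearMap.mulRight k (Smith.gen q _ 0) ∘ₗ
      fockToSmith q a) fun n i p => ?_) f
  simp only [LinearMap.comp_apply, fockY_mon, fockToSmith_mon, LinearMap.mulRight_apply]
  rw [pow_succ, ← mul_assoc, ← mul_assoc, ← mul_assoc]

omit hq in
theorem pow_mul_of_mul_eq_smul {R : Type*} [Ring R] [Algebra k R] {z u : R} {c : k}
    (h : z * u = c • (u * z)) (n : ℕ) (e : k) : z ^ n * (e • u) = ((c ^ n * e) • u) * z ^ n := by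
  induction n generalizing e with
  | zero => simp
  | succ n ih =>
    rw [pow_succ', mul_assoc, ih, ← mul_assoc, mul_smul_comm, h, smul_smul, smul_mul_assoc,
      ← mul_assoc, pow_succ' c, mul_comm (c ^ n * e) c, mul_assoc c, smul_mul_assoc,
      mul_assoc, smul_mul_assoc, mul_assoc]

theorem smith_yh : Smith.gen q (smithPoly q a) 0 * Smith.gen q _ 1
    = q⁻¹ • (Smith.gen q _ 1 * Smith.gen q _ 0) := by
  rw [Smith.hy, inv_smul_smul₀ hq]

theorem fockToSmith_fockH (f : Fock k) :
    fockToSmith q a (fockH q f) = fockToSmith q a f * Smith.gen q _ 1 := by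
  refine LinearMap.congr_fun (Fock.hom_ext
    (f := fockToSmith q a ∘ₗ fockH q) (g := LinearMap.mulRight k (Smith.gen q _ 1) ∘ₗ
      fockToSmith q a) fun n i p => ?_) f
  simp only [LinearMap.comp_apply, fockH_mon, fockToSmith_mon, LinearMap.mulRight_apply]
  have h1 := pow_mul_of_mul_eq_smul (smith_yh a hq) n 1
  have h2 := pow_mul_of_mul_eq_smul (Smith.xh q (smithPoly q a)) i (q⁻¹ ^ n)
  rw [one_smul, mul_one] at h1
  rw [mul_assoc (Polynomial.aeval _ p), mul_assoc (_ ^ i), h1, ← mul_assoc (_ ^ i), h2,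
    mul_comm _ p, map_mul, map_mul, Polynomial.aeval_X, Polynomial.aeval_C,
    ← Algebra.smul_def, mul_assoc, mul_assoc]

theorem fockToSmith_fockX (f : Fock k) :
    fockToSmith q a (fockX q a f) = fockToSmith q a f * Smith.gen q _ 2 := by
  refine LinearMap.congr_fun (Fock.hom_ext
    (f := fockToSmith q a ∘ₗ fockX q a) (g := LinearMap.mulRight k (Smith.gen q _ 2) ∘ₗ
      fockToSmith q a) fun n i p => ?_) f
  simp only [LinearMap.comp_apply, LinearMap.mulRight_apply]
  cases n with
  | zero =>
    simp only [fockX_mon_zero, fockToSmith_mon, pow_zero, mul_one]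
    rw [pow_succ, mul_assoc]
  | succ n =>
    simp only [fockX_mon_succ, fockToSmith_mon, map_add]
    set Y := Smith.gen q (smithPoly q a) 0
    set H := Smith.gen q (smithPoly q a) 1
    set X := Smith.gen q (smithPoly q a) 2
    have hΩ : Y * X = X * Y - Polynomial.aeval (q • H) a + Polynomial.aeval H a := by
      have := (Smith.xy q (smithPoly q a)).trans (aeval_smithPoly q a _)
      rw [sub_eq_iff_eq_add] at this
      change X * Y = _ at this
      rw [this]
      abel
    -- Centrality of `Ω` replaces an induction on `n`: in `Y^(n+1) X = Y^n Ω + Y^n a(H)` the factor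
    -- `Ω` moves to the left, where it is expanded as `XY - a(qH)`.
    have hcomm : Y ^ n * (Y * X - Polynomial.aeval H a) = (Y * X - Polynomial.aeval H a) * Y ^ n :=
      (Subalgebra.mem_center_iff.1 (omega_mem_center q a) (Y ^ n) :)
    have h1 : Y ^ n * Polynomial.aeval H a = Polynomial.aeval (q⁻¹ ^ n • H) a * Y ^ n := by
      refine mul_aeval_of_mul_eq ?_ a
      simpa using pow_mul_of_mul_eq_smul (smith_yh a hq) n 1
    have h2 : ∀ c, X ^ i * Polynomial.aeval (c • H) a
        = Polynomial.aeval ((q ^ i * c) • H) a * X ^ i := fun c =>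
      mul_aeval_of_mul_eq (pow_mul_of_mul_eq_smul (Smith.xh q (smithPoly q a)) i c) a
    have h3 : Y ^ (n + 1) * X = X * Y ^ (n + 1) - Polynomial.aeval (q • H) a * Y ^ n
        + Polynomial.aeval (q⁻¹ ^ n • H) a * Y ^ n := by
      rw [← h1, pow_succ, mul_assoc, ← sub_eq_iff_eq_add, ← mul_sub, hcomm, hΩ,
        add_sub_cancel_right, sub_mul, mul_assoc, ← pow_succ', ← pow_succ]
    rw [mul_assoc (Polynomial.aeval _ p), mul_assoc (_ ^ i), h3, mul_add, mul_sub,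
      ← mul_assoc (X ^ i) (Polynomial.aeval _ _), ← mul_assoc (X ^ i) (Polynomial.aeval _ _),
      h2, h2, mul_comm _ p, map_mul, map_sub, ← aeval_smul, ← aeval_smul]
    simp only [mul_add, mul_sub, sub_mul, mul_assoc, pow_succ X]
    abel

/-- The comparison map is right `B`-linear, since it is so for the generators. Evaluated at the
vacuum this gives surjectivity, the spanning half of PBW. -/
theorem fockToSmith_fockAction (b : Smith q (smithPoly q a)) (f : Fock k) :
    fockToSmith q a ((fockAction a hq b).unop f) = fockToSmith q a f * b := by
  let S : Subalgebra k (Smith q (smithPoly q a)) :=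
    { carrier := {b | ∀ f, fockToSmith q a ((fockAction a hq b).unop f) = fockToSmith q a f * b}
      mul_mem' := fun {b c} hb hc f => by
        rw [map_mul, MulOpposite.unop_mul, Module.End.mul_apply, hc, hb, mul_assoc]
      add_mem' := fun {b c} hb hc f => by
        rw [map_add, MulOpposite.unop_add, LinearMap.add_apply, map_add, hb, hc, mul_add]
      algebraMap_mem' := fun r f => by
        rw [AlgHom.commutes, MulOpposite.algebraMap_apply, MulOpposite.unop_op,
          Module.algebraMap_end_apply, map_smul, ← Algebra.commutes, Algebra.smul_def] }
  refine Smith.mem_of_gen_mem S (fun i f => ?_) b f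
  rw [fockAction_gen]
  fin_cases i
  · exact fockToSmith_fockY a f
  · exact fockToSmith_fockH a hq f
  · exact fockToSmith_fockX a hq f

theorem fockToSmith_surjective : Function.Surjective (fockToSmith q a) := fun b =>
  ⟨(fockAction a hq b).unop (mon 0 0 1), by
    rw [fockToSmith_fockAction, fockToSmith_mon]; simp⟩

/-! ### The projection of the model onto `A` -/

omit hq in
variable (q) in
/-- The projection `p(H) X ^ i Y ^ n ↦ p(h) x ^ i y ^ n`. -/
def fockToGWA : Fock k →ₗ[k] GWA q a := (smithToGWA q a).toLinearMap ∘ₗ fockToSmith q a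

omit hq in
theorem fockToGWA_fockY (f : Fock k) :
    fockToGWA q a (fockY f) = fockToGWA q a f * GWA.gen q a 0 := by
  simp [fockToGWA, fockToSmith_fockY, smithToGWA_gen]

theorem fockToGWA_fockH (f : Fock k) :
    fockToGWA q a (fockH q f) = fockToGWA q a f * GWA.gen q a 1 := by
  simp [fockToGWA, fockToSmith_fockH a hq, smithToGWA_gen]

theorem fockToGWA_fockX (f : Fock k) :
    fockToGWA q a (fockX q a f) = fockToGWA q a f * GWA.gen q a 2 := by
  simp [fockToGWA, fockToSmith_fockX a hq, smithToGWA_gen]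

omit hq in
theorem fockToGWA_one : fockToGWA q a (mon 0 0 1) = 1 := by
  simp [fockToGWA, fockToSmith_mon]

theorem fockToGWA_surjective : Function.Surjective (fockToGWA q a) :=
  (smithToGWA_surjective q a).comp (fockToSmith_surjective a hq)

theorem fockAction_omega : fockAction a hq (Omega q a) = MulOpposite.op (fockOmega q a) := by
  rw [Omega, map_sub, map_mul, ← Polynomial.aeval_algHom_apply, fockAction_gen, fockAction_gen,
    fockAction_gen]
  change MulOpposite.op _ * MulOpposite.op _ - Polynomial.aeval (MulOpposite.op _) a = _
  rw [Polynomial.aeval_op_apply, ← MulOpposite.op_mul, ← MulOpposite.op_sub, fockOmega]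

/-- The identification of the kernel of `B → A` with `BΩ`, transported to the model through the PBW
bijection. -/
theorem fockOmega_exact : Function.Exact (fockOmega q a) (fockToGWA q a) := by
  have hΩ : ∀ f, fockToSmith q a (fockOmega q a f) = fockToSmith q a f * Omega q a := fun f => by
    rw [← fockToSmith_fockAction a hq, fockAction_omega, MulOpposite.unop_op]
  intro f
  change smithToGWA q a (fockToSmith q a f) = 0 ↔ _
  rw [smithToGWA_eq_zero_iff]
  constructor
  · rintro ⟨c, hc⟩
    obtain ⟨g, rfl⟩ := fockToSmith_surjective a hq c
    exact ⟨g, fockToSmith_injective a hq (by rw [hΩ, hc])⟩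
  · rintro ⟨g, rfl⟩
    exact ⟨_, hΩ g⟩

end Fock

/-! ### The six inner operators on a tensor product with `A` -/

section TensorOps

variable {k : Type u} [Field k] (q : k) (a : k[X])
  {F : Type*} [AddCommGroup F] [Module k F]

/-- The six operators on `F ⊗ A`, where `A` acts on itself from the left and `F` carries three
operators playing the roles of the right multiplications by `y`, `h`, `x`. -/
def tensorOps (ρy ρh ρx : Module.End k F) : Ops k (F ⊗[k] GWA q a) where
  ly := LinearMap.lTensor F (LinearMap.mulLeft k (GWA.gen q a 0))
  lh := LinearMap.lTensor F (LinearMap.mulLeft k (GWA.gen q a 1))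
  lx := LinearMap.lTensor F (LinearMap.mulLeft k (GWA.gen q a 2))
  ry := LinearMap.rTensor (GWA q a) ρy
  rh := LinearMap.rTensor (GWA q a) ρh
  rx := LinearMap.rTensor (GWA q a) ρx

variable {q a} {ρy ρh ρx : Module.End k F}

theorem aeval_rTensor (M : Type*) [AddCommGroup M] [Module k M] (ρ : Module.End k F) (b : k[X]) :
    Polynomial.aeval (LinearMap.rTensor M ρ : Module.End k (F ⊗[k] M)) b
      = LinearMap.rTensor M (Polynomial.aeval ρ b) :=
  Polynomial.aeval_algHom_apply (Module.End.rTensorAlgHom k F M) ρ b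

theorem aeval_lTensor (M : Type*) [AddCommGroup M] [Module k M] (ρ : Module.End k M) (b : k[X]) :
    Polynomial.aeval (LinearMap.lTensor F ρ : Module.End k (F ⊗[k] M)) b
      = LinearMap.lTensor F (Polynomial.aeval ρ b) :=
  Polynomial.aeval_algHom_apply (Module.End.lTensorAlgHom k M F) ρ b

theorem aeval_mulLeft {R : Type*} [Ring R] [Algebra k R] (r : R) (b : k[X]) :
    Polynomial.aeval (LinearMap.mulLeft k r) b = LinearMap.mulLeft k (Polynomial.aeval r b) :=
  Polynomial.aeval_algHom_apply (Algebra.lmul k R) r b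

theorem aeval_mulRight {R : Type*} [Ring R] [Algebra k R] (r : R) (b : k[X]) :
    Polynomial.aeval (LinearMap.mulRight k r) b = LinearMap.mulRight k (Polynomial.aeval r b) := by
  ext s
  rw [LinearMap.mulRight_apply]
  induction b using Polynomial.induction_on generalizing s with
  | C c => simp [Module.algebraMap_end_apply, Algebra.smul_def, Algebra.commutes]
  | add b c hb hc => simp only [map_add, LinearMap.add_apply, hb, hc, mul_add]
  | monomial m c ih =>
    rw [pow_succ, ← mul_assoc, map_mul _ (Polynomial.C c * _),
      map_mul _ (Polynomial.C c * _), Polynomial.aeval_X, Polynomial.aeval_X,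
      Module.End.mul_apply, ih, LinearMap.mulRight_apply, mul_assoc, mul_aeval_of_mul_eq rfl]

theorem commute_rTensor_lTensor {M : Type*} [AddCommGroup M] [Module k M] (f : Module.End k F)
    (g : Module.End k M) :
    Commute (LinearMap.rTensor M f : Module.End k (F ⊗[k] M)) (LinearMap.lTensor F g) := by
  refine TensorProduct.ext' fun u v => ?_
  simp

theorem tensorOps_casimir :
    (tensorOps q a ρy ρh ρx).casimir a
      = LinearMap.rTensor (GWA q a) (ρx * ρy - Polynomial.aeval ρh a) := by
  rw [Ops.casimir, tensorOps, aeval_rTensor, ← LinearMap.rTensor_mul, ← LinearMap.rTensor_sub]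

theorem tensorOps_isSmith (hrx : ρh * ρx = q • (ρx * ρh)) (hry : ρy * ρh = q • (ρh * ρy))
    (hyx : ρy * ρx - ρx * ρy = Polynomial.aeval (q • ρh) a - Polynomial.aeval ρh a) :
    (tensorOps q a ρy ρh ρx).IsSmith q a where
  ry_ly := commute_rTensor_lTensor _ _
  ry_lh := commute_rTensor_lTensor _ _
  ry_lx := commute_rTensor_lTensor _ _
  rh_ly := commute_rTensor_lTensor _ _
  rh_lh := commute_rTensor_lTensor _ _
  rh_lx := commute_rTensor_lTensor _ _
  rx_ly := commute_rTensor_lTensor _ _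
  rx_lh := commute_rTensor_lTensor _ _
  rx_lx := commute_rTensor_lTensor _ _
  lh_ly := by
    simp only [tensorOps]
    rw [← LinearMap.lTensor_mul, ← LinearMap.lTensor_mul, ← LinearMap.lTensor_smul]
    congr 1
    ext r
    simp [← mul_assoc, GWA.hy]
  lx_lh := by
    simp only [tensorOps]
    rw [← LinearMap.lTensor_mul, ← LinearMap.lTensor_mul, ← LinearMap.lTensor_smul]
    congr 1
    ext r
    simp [← mul_assoc, GWA.xh]
  ly_lx := by
    simp only [tensorOps]
    rw [← LinearMap.lTensor_mul, aeval_lTensor, aeval_mulLeft]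
    congr 1
    ext r
    simp [← mul_assoc, GWA.yx]
  lx_ly := by
    simp only [tensorOps]
    rw [← LinearMap.lTensor_mul, aeval_smul, aeval_lTensor, aeval_mulLeft, ← aeval_smul]
    congr 1
    ext r
    simp [← mul_assoc, GWA.xy]
  rh_rx := by
    simp only [tensorOps]
    rw [← LinearMap.rTensor_mul, ← LinearMap.rTensor_mul, ← LinearMap.rTensor_smul, hrx]
  ry_rh := by
    simp only [tensorOps]
    rw [← LinearMap.rTensor_mul, ← LinearMap.rTensor_mul, ← LinearMap.rTensor_smul, hry]
  ry_rx := by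
    simp only [tensorOps]
    rw [← LinearMap.rTensor_mul, ← LinearMap.rTensor_mul, ← LinearMap.rTensor_sub, hyx,
      LinearMap.rTensor_sub, ← aeval_rTensor, ← aeval_rTensor, LinearMap.rTensor_smul]

end TensorOps

/-! ### The homology of the rows over `A ⊗ A`, from the model over `B ⊗ A` -/

section Concrete

variable {k : Type u} [Field k] (q : k) (a : k[X])

/-- The operators on `A ⊗ A` given by inner multiplication. -/
def gwaOps : Ops k (GWA q a ⊗[k] GWA q a) :=
  tensorOps q a (LinearMap.mulRight k (GWA.gen q a 0)) (LinearMap.mulRight k (GWA.gen q a 1))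
    (LinearMap.mulRight k (GWA.gen q a 2))

/-- The operators on the tensor product of the model of the Smith algebra with `A`. -/
def fockOps : Ops k (Fock k ⊗[k] GWA q a) := tensorOps q a fockY (fockH q) (fockX q a)

theorem gwaOps_casimir : (gwaOps q a).casimir a = 0 := by
  rw [gwaOps, tensorOps_casimir, aeval_mulRight]
  have : LinearMap.mulRight k (GWA.gen q a 2) * LinearMap.mulRight k (GWA.gen q a 0)
      - LinearMap.mulRight k (Polynomial.aeval (GWA.gen q a 1) a) = 0 := by
    ext r
    simp [mul_assoc, GWA.yx]
  rw [this, LinearMap.rTensor_zero]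

theorem gwaOps_isSmith : (gwaOps q a).IsSmith q a := by
  refine tensorOps_isSmith ?_ ?_ ?_
  · ext r
    simp [mul_assoc, GWA.xh]
  · ext r
    simp [mul_assoc, GWA.hy]
  · rw [aeval_smul, aeval_mulRight, aeval_mulRight, ← aeval_smul]
    ext r
    simp [mul_assoc, GWA.xy, GWA.yx]

variable {q}

theorem fockOps_isSmith (hq : q ≠ 0) : (fockOps q a).IsSmith q a :=
  tensorOps_isSmith (fock_rh_rx a hq) (fock_ry_rh hq) (fock_ry_rx a hq)

theorem fockOps_casimir : (fockOps q a).casimir a = (fockOmega q a).rTensor (GWA q a) :=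
  tensorOps_casimir

theorem fockOps_intertwines (hq : q ≠ 0) :
    (fockOps q a).Intertwines (gwaOps q a) ((fockToGWA q a).rTensor (GWA q a)) := by
  have hL : ∀ (g : Module.End k (GWA q a)) (e : Fock k ⊗[k] GWA q a),
      (fockToGWA q a).rTensor (GWA q a) (g.lTensor _ e)
        = g.lTensor _ ((fockToGWA q a).rTensor (GWA q a) e) := fun g e => by
    rw [← LinearMap.comp_apply, ← LinearMap.comp_apply, LinearMap.rTensor_comp_lTensor,
      LinearMap.lTensor_comp_rTensor]
  have hR : ∀ (ρ : Module.End k (Fock k)) (i : Fin 3)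
      (_ : ∀ f, fockToGWA q a (ρ f) = fockToGWA q a f * GWA.gen q a i)
      (e : Fock k ⊗[k] GWA q a), (fockToGWA q a).rTensor (GWA q a) (ρ.rTensor _ e)
        = (LinearMap.mulRight k (GWA.gen q a i)).rTensor _
          ((fockToGWA q a).rTensor (GWA q a) e) := fun ρ i h e => by
    rw [← LinearMap.comp_apply, ← LinearMap.comp_apply, ← LinearMap.rTensor_comp,
      ← LinearMap.rTensor_comp]
    congr 2
    exact LinearMap.ext h
  exact ⟨hL _, hL _, hL _, hR _ 0 (fockToGWA_fockY a), hR _ 1 (fockToGWA_fockH a hq),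
    hR _ 2 (fockToGWA_fockX a hq)⟩

/-- The inclusion of the span of the `H ^ j X ^ i`. -/
def fockIncl : FockR k →ₗ[k] Fock k := Finsupp.lsingle 0

/-- Right multiplication by `H` on the span of the `H ^ j X ^ i`. -/
def fockRH (q : k) : Module.End k (FockR k) :=
  FockR.lift fun i => FockR.single i ∘ₗ
    LinearMap.mulLeft k (Polynomial.C (q ^ i) * Polynomial.X)

/-- Right multiplication by `X` on the span of the `H ^ j X ^ i`. -/
def fockRX : Module.End k (FockR k) := FockR.lift fun i => FockR.single (i + 1)

theorem fockH_fockIncl (f : FockR k) : fockH q (fockIncl f) = fockIncl (fockRH q f) := by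
  refine LinearMap.congr_fun (FockR.hom_ext (f := fockH q ∘ₗ fockIncl)
    (g := fockIncl ∘ₗ fockRH q) fun i p => ?_) f
  have : fockH q (fockIncl (FockR.single i p)) = _ := fockH_mon q 0 i p
  rw [LinearMap.comp_apply, LinearMap.comp_apply, this, fockRH, FockR.lift_single]
  simp [fockIncl, mon, mul_assoc]

theorem fockX_fockIncl (f : FockR k) : fockX q a (fockIncl f) = fockIncl (fockRX f) := by
  refine LinearMap.congr_fun (FockR.hom_ext (f := fockX q a ∘ₗ fockIncl)
    (g := fockIncl ∘ₗ fockRX) fun i p => ?_) f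
  have : fockX q a (fockIncl (FockR.single i p)) = _ := fockX_mon_zero q a i p
  rw [LinearMap.comp_apply, LinearMap.comp_apply, this, fockRX, FockR.lift_single]
  rfl

theorem fockRH_single_zero (p : k[X]) :
    fockRH q (FockR.single 0 p) = FockR.single 0 (LinearMap.mulLeft k Polynomial.X p) := by
  rw [fockRH, FockR.lift_single]
  simp

/-- The flag is `k ⊂ k[H] ⊂ span(H^j X^i) ⊂ B`, tensored with `A`. With `Y` written last, right
multiplication by `Y` is a pure shift, and those by `H` and `X` preserve the part without `Y`; the
same holds one step lower for `X` and `H`. The leading coefficient of `ly - q • ry` is `-q`, hence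
the need for `q ≠ 0`, while that of `q • lx - rx` is `-1`. -/
theorem fockOps_flag (hq : q ≠ 0) :
    (fockOps q a).Flag q (fockIncl.rTensor (GWA q a)) ((FockR.single 0).rTensor (GWA q a))
      ((Polynomial.monomial 0 : k →ₗ[k] k[X]).rTensor (GWA q a))
      ((LinearMap.mulLeft k (GWA.gen q a 1)).lTensor _) ((fockRH q).rTensor _)
      ((LinearMap.mulLeft k (GWA.gen q a 2)).lTensor _) (fockRX.rTensor _)
      ((LinearMap.mulLeft k (GWA.gen q a 1)).lTensor _)
      ((LinearMap.mulLeft k Polynomial.X).rTensor _) := by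
  have hL : ∀ {F F' : Type u} [AddCommGroup F] [Module k F] [AddCommGroup F'] [Module k F']
      (j : F →ₗ[k] F') (g : Module.End k (GWA q a)) (e : F ⊗[k] GWA q a),
      g.lTensor _ (j.rTensor (GWA q a) e) = j.rTensor (GWA q a) (g.lTensor _ e) := by
    intro F F' _ _ _ _ j g e
    rw [← LinearMap.comp_apply, ← LinearMap.comp_apply, LinearMap.rTensor_comp_lTensor,
      LinearMap.lTensor_comp_rTensor]
  have hR : ∀ {F F' : Type u} [AddCommGroup F] [Module k F] [AddCommGroup F'] [Module k F']
      (j : F →ₗ[k] F') (ρ : Module.End k F) (ρ' : Module.End k F')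
      (_ : ∀ f, ρ' (j f) = j (ρ f)) (e : F ⊗[k] GWA q a),
      ρ'.rTensor _ (j.rTensor (GWA q a) e) = j.rTensor (GWA q a) (ρ.rTensor _ e) := by
    intro F F' _ _ _ _ j ρ ρ' h e
    rw [← LinearMap.comp_apply, ← LinearMap.comp_apply, ← LinearMap.rTensor_comp,
      ← LinearMap.rTensor_comp]
    congr 2
    exact LinearMap.ext h
  have hdivY : ∀ c : k, c ≠ 0 →
      IsDivision (fockIncl.rTensor (GWA q a)) ((fockOps q a).ly - c • (fockOps q a).ry) := by
    intro c hc
    have := isDivision_tensor (M := GWA q a) (i := fockIncl (k := k)) (ρ := fockY)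
      (LinearEquiv.refl k (Fock k)) (fun _ => rfl) (fun _ => rfl)
      (LinearMap.mulLeft k (GWA.gen q a 0)) 1 hc
    rwa [one_smul] at this
  have hdivX : ∀ c : k, IsDivision ((FockR.single 0).rTensor (GWA q a))
      (c • (LinearMap.mulLeft k (GWA.gen q a 2)).lTensor (FockR k) - fockRX.rTensor _) := by
    intro c
    have := isDivision_tensor (M := GWA q a) (i := FockR.single (k := k) 0) (ρ := fockRX)
      (LinearEquiv.refl k (FockR k) : FockR k ≃ₗ[k] ℕ →₀ k[X]) (fun _ => rfl) (fun b => by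
        refine LinearMap.congr_fun (FockR.hom_ext (N := FockR k) (f := fockRX)
          (g := (Finsupp.lmapDomain k[X] k Nat.succ : (ℕ →₀ k[X]) →ₗ[k] ℕ →₀ k[X]))
          fun i p => ?_) b
        refine (FockR.lift_single _ i p).trans ?_
        exact (Finsupp.mapDomain_single (f := Nat.succ)).symm)
      (LinearMap.mulLeft k (GWA.gen q a 2)) c one_ne_zero
    rwa [one_smul] at this
  refine ⟨hL _ _, hR _ _ _ fockH_fockIncl, hL _ _, hR _ _ _ (fockX_fockIncl a), hL _ _,
    hR _ _ _ fockRH_single_zero, ?_, hdivY q hq, ?_, hdivX q, ?_⟩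
  · simpa using hdivY 1 one_ne_zero
  · simpa using hdivX 1
  · have := isDivision_tensor (M := GWA q a) (i := (Polynomial.monomial 0 : k →ₗ[k] k[X]))
      (ρ := LinearMap.mulLeft k Polynomial.X) (Polynomial.basisMonomials k).repr
      (fun s => by
        have : (Polynomial.monomial 0 s : k[X]) = s • Polynomial.basisMonomials k 0 := by
          simp [Polynomial.smul_eq_C_mul]
        rw [this, map_smul, Module.Basis.repr_self, Finsupp.smul_single, smul_eq_mul, mul_one])
      (fun b => by
        induction b using Polynomial.induction_on' with
        | add b c hb hc => rw [map_add, map_add, hb, hc, map_add, map_add]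
        | monomial n c =>
          have h : ∀ n, (Polynomial.monomial n c : k[X]) = c • Polynomial.basisMonomials k n :=
            fun n => by simp [Polynomial.smul_monomial]
          rw [LinearMap.mulLeft_apply, Polynomial.X_mul_monomial, h, h, map_smul, map_smul,
            Module.Basis.repr_self, Module.Basis.repr_self, map_smul, Finsupp.lmapDomain_apply,
            Finsupp.mapDomain_single])
      (LinearMap.mulLeft k (GWA.gen q a 1)) 1 one_ne_zero
    rwa [one_smul, one_smul] at this

theorem gwaOps_rowHomology (hq : q ≠ 0) : (gwaOps q a).RowHomology q a := by
  have hex := rTensor_exact (GWA q a) (fockOmega_exact a hq) (fockToGWA_surjective a hq)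
  refine ((fockOps_flag a hq).rowExact (fockOps_isSmith a hq)).reduce (fockOps_isSmith a hq)
    (fockOps_intertwines a hq) (LinearMap.rTensor_surjective _ (fockToGWA_surjective a hq))
    (fun e he => ?_) (fun e => ?_) (fun e he => ?_)
  · rw [fockOps_casimir]
    exact (hex e).1 he
  · rw [fockOps_casimir]
    exact (hex _).2 ⟨e, rfl⟩
  · rw [fockOps_casimir] at he
    exact (Module.Flat.rTensor_preserves_injective_linearMap (M := GWA q a) (fockOmega q a)
      (fockOmega_injective a)) (he.trans (map_zero _).symm)

theorem mul'_d₁ (v) : LinearMap.mul' k (GWA q a) ((gwaOps q a).d₁ v) = 0 := by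
  have h : ∀ (i : Fin 3) (e : GWA q a ⊗[k] GWA q a),
      LinearMap.mul' k (GWA q a) ((LinearMap.mulLeft k (GWA.gen q a i)).lTensor _ e)
        = LinearMap.mul' k (GWA q a) ((LinearMap.mulRight k (GWA.gen q a i)).rTensor _ e) := by
    intro i e
    induction e with
    | zero => simp
    | add e f he hf => simp only [map_add, he, hf]
    | tmul r s => simp [mul_assoc]
  obtain ⟨f, g, e⟩ := v
  simp only [Ops.d₁_apply, gwaOps, tensorOps, map_add, map_sub, h, sub_self, add_zero]

/-- The three divisions bring every element of `A ⊗ A` to the form `1 ⊗ b` modulo boundaries.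
Multiplication kills boundaries and sends `1 ⊗ b` to `b`. -/
theorem exists_d₁_of_mul'_eq_zero (hq : q ≠ 0) (e : GWA q a ⊗[k] GWA q a)
    (he : LinearMap.mul' k (GWA q a) e = 0) : ∃ v, (gwaOps q a).d₁ v = e := by
  obtain ⟨e, rfl⟩ := LinearMap.rTensor_surjective (GWA q a) (fockToGWA_surjective a hq) e
  obtain ⟨m, v, rfl⟩ := (fockOps_flag a hq).exists_eq e
  obtain ⟨b, rfl⟩ := (TensorProduct.lid k (GWA q a)).symm.surjective m
  have h1 : (fockToGWA q a).rTensor (GWA q a) (fockIncl.rTensor (GWA q a)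
      ((FockR.single 0).rTensor (GWA q a)
        ((Polynomial.monomial 0 : k →ₗ[k] k[X]).rTensor (GWA q a)
          ((TensorProduct.lid k (GWA q a)).symm b)))) = 1 ⊗ₜ b := by
    simp only [TensorProduct.lid_symm_apply, LinearMap.rTensor_tmul, Polynomial.monomial_zero_one]
    congr 1
    exact fockToGWA_one a
  rw [map_add, (fockOps_intertwines a hq).d₁, map_add, mul'_d₁, h1, add_zero,
    LinearMap.mul'_apply, one_mul] at he
  subst he
  refine ⟨((fockToGWA q a).rTensor (GWA q a)).prodMap
    (((fockToGWA q a).rTensor (GWA q a)).prodMap ((fockToGWA q a).rTensor (GWA q a))) v, ?_⟩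
  rw [map_add, (fockOps_intertwines a hq).d₁, h1, TensorProduct.tmul_zero, zero_add]

end Concrete

section Coordinates

variable {k : Type u} [Field k] (q : k) (a : k[X])

/-! ### Coordinates on the terms of the double complex -/

/-- The map `u ⊗ v ↦ u|w|v` for a word `w`. -/
def emb {j : ℕ} (w : Fin j → Fin 3) : GWA q a ⊗[k] GWA q a →ₗ[k] Term q a j :=
  LinearMap.lTensor (GWA q a) (TensorProduct.mk k (⋀[k]^j (V k)) (GWA q a) (wedge w))

/-- The coordinate along a strictly increasing word. -/
def coef {j : ℕ} (w : Fin j → Fin 3) : Term q a j →ₗ[k] GWA q a ⊗[k] GWA q a :=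
  LinearMap.lTensor (GWA q a)
    ((TensorProduct.lid k (GWA q a)).toLinearMap ∘ₗ LinearMap.rTensor (GWA q a) (coord w))

variable {q a}

theorem emb_tmul {j : ℕ} (w : Fin j → Fin 3) (u v : GWA q a) :
    emb q a w (u ⊗ₜ v) = el q a u w v := rfl

theorem coef_el {j : ℕ} (w w' : Fin j → Fin 3) (u v : GWA q a) :
    coef q a w (el q a u w' v) = coord w (wedge w' : ⋀[k]^j (V k)) • (u ⊗ₜ v) := by
  rw [← TensorProduct.tmul_smul]
  rfl

theorem coef_emb {j : ℕ} (w w' : Fin j → Fin 3) (t : GWA q a ⊗[k] GWA q a) :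
    coef q a w (emb q a w' t) = coord w (wedge w' : ⋀[k]^j (V k)) • t := by
  induction t with
  | zero => simp
  | add s t hs ht => rw [map_add, map_add, hs, ht, smul_add]
  | tmul u v => exact coef_el w w' u v

theorem span_wedge (j : ℕ) :
    Submodule.span k {m : ⋀[k]^j (V k) | ∃ w : Fin j → Fin 3, StrictMono w ∧ m = wedge w} = ⊤ := by
  rw [eq_top_iff, ← exteriorPower.ιMulti_family_span_of_span k (Pi.basisFun k (Fin 3)).span_eq]
  refine Submodule.span_mono ?_
  rintro _ ⟨s, rfl⟩
  refine ⟨Set.powersetCard.ofFinEmbEquiv.symm s, OrderEmbedding.strictMono _, ?_⟩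
  rw [exteriorPower.ιMulti_family, wedge]
  congr 1
  ext i : 1
  simp

/-- Reduces every check on a term of the double complex to increasing basis words, which span the
exterior power. -/
theorem Term.hom_ext {j : ℕ} {N : Type*} [AddCommGroup N] [Module k N]
    {f g : Term q a j →ₗ[k] N}
    (h : ∀ w : Fin j → Fin 3, StrictMono w → ∀ t, f (emb q a w t) = g (emb q a w t)) : f = g := by
  have key : ∀ (u : GWA q a) (m : ⋀[k]^j (V k)) (v : GWA q a), f (tri u m v) = g (tri u m v) := by
    intro u m v
    have hm : m ∈ Submodule.span k
        {m : ⋀[k]^j (V k) | ∃ w : Fin j → Fin 3, StrictMono w ∧ m = wedge w} := by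
      rw [span_wedge]
      trivial
    induction hm using Submodule.span_induction with
    | mem m hm =>
      obtain ⟨w, hw, rfl⟩ := hm
      exact h w hw (u ⊗ₜ v)
    | zero =>
      have : (tri u 0 v : Term q a j) = 0 := by
        change u ⊗ₜ[k] ((0 : ⋀[k]^j (V k)) ⊗ₜ[k] v) = 0
        rw [TensorProduct.zero_tmul, TensorProduct.tmul_zero]
      rw [this, map_zero, map_zero]
    | add m n _ _ hm hn =>
      have : (tri u (m + n) v : Term q a j) = tri u m v + tri u n v := by
        change u ⊗ₜ[k] ((m + n) ⊗ₜ[k] v) = u ⊗ₜ[k] (m ⊗ₜ[k] v) + u ⊗ₜ[k] (n ⊗ₜ[k] v)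
        rw [TensorProduct.add_tmul, TensorProduct.tmul_add]
      rw [this, map_add, map_add, hm, hn]
    | smul c m _ hm =>
      have : (tri u (c • m) v : Term q a j) = c • tri u m v := by
        change u ⊗ₜ[k] ((c • m) ⊗ₜ[k] v) = c • (u ⊗ₜ[k] (m ⊗ₜ[k] v))
        rw [← TensorProduct.smul_tmul', TensorProduct.tmul_smul]
      rw [this, map_smul, map_smul, hm]
  refine TensorProduct.ext' fun u t => ?_
  induction t with
  | zero => rw [TensorProduct.tmul_zero]; exact (map_zero f).trans (map_zero g).symm
  | add s t hs ht =>
    rw [TensorProduct.tmul_add]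
    exact (map_add f _ _).trans ((congrArg₂ _ hs ht).trans (map_add g _ _).symm)
  | tmul m v => exact key u m v

theorem Term.subsingleton {j : ℕ} (hj : 4 ≤ j) : Subsingleton (Term q a j) := by
  have h : (LinearMap.id : Term q a j →ₗ[k] Term q a j) = 0 := Term.hom_ext fun w hw => by
    have := Fintype.card_le_of_injective w hw.injective
    simp at this
    omega
  exact ⟨fun s t => (LinearMap.congr_fun h s).trans (LinearMap.congr_fun h t).symm⟩

theorem strictMono_fin_one (w : Fin 1 → Fin 3) : w = ![0] ∨ w = ![1] ∨ w = ![2] := by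
  decide +revert

theorem strictMono_fin_two (w : Fin 2 → Fin 3) (hw : StrictMono w) :
    w = ![1, 2] ∨ w = ![0, 2] ∨ w = ![0, 1] := by
  have : w 0 < w 1 := hw (by decide)
  decide +revert

theorem strictMono_fin_three (w : Fin 3 → Fin 3) (hw : StrictMono w) : w = ![0, 1, 2] := by
  have h1 : w 0 < w 1 := hw (by decide)
  have h2 : w 1 < w 2 := hw (by decide)
  decide +revert

variable (q a)

/-- Coordinates in exterior degree one. -/
def emb₁ (v : (GWA q a ⊗[k] GWA q a) × (GWA q a ⊗[k] GWA q a) × (GWA q a ⊗[k] GWA q a)) :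
    Term q a 1 :=
  emb q a ![0] v.1 + emb q a ![1] v.2.1 + emb q a ![2] v.2.2

/-- Coordinates in exterior degree two. -/
def emb₂ (v : (GWA q a ⊗[k] GWA q a) × (GWA q a ⊗[k] GWA q a) × (GWA q a ⊗[k] GWA q a)) :
    Term q a 2 :=
  emb q a ![1, 2] v.1 + emb q a ![0, 2] v.2.1 + emb q a ![0, 1] v.2.2

theorem coord_wedge_one (i j : Fin 3) :
    coord ![i] (wedge ![j] : ⋀[k]^1 (V k)) = if i = j then 1 else 0 := by
  rw [coord_wedge]
  simp

theorem coord_wedge_two (i j l m : Fin 3) :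
    coord ![i, j] (wedge ![l, m] : ⋀[k]^2 (V k))
      = (if i = l then 1 else 0) * (if j = m then 1 else 0)
        - (if i = m then 1 else 0) * (if j = l then 1 else 0) := by
  rw [coord_wedge, Matrix.det_fin_two]
  change (if i = l then (1 : k) else 0) * (if j = m then 1 else 0)
    - (if j = l then 1 else 0) * (if i = m then 1 else 0) = _
  rw [mul_comm (if j = l then (1 : k) else 0)]

theorem coord_wedge_zero : coord ![] (wedge ![] : ⋀[k]^0 (V k)) = 1 := by
  rw [coord_wedge, Matrix.det_isEmpty]

theorem coord_wedge_three : coord ![0, 1, 2] (wedge ![0, 1, 2] : ⋀[k]^3 (V k)) = 1 := by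
  rw [coord_wedge, Matrix.det_fin_three]
  simp

theorem emb_zero_bijective : Function.Bijective (emb q a ![]) := by
  refine ⟨Function.LeftInverse.injective (g := coef q a ![]) fun t => ?_,
    Function.RightInverse.surjective (g := coef q a ![]) fun t => ?_⟩
  · rw [coef_emb, coord_wedge_zero, one_smul]
  · refine LinearMap.congr_fun (Term.hom_ext (f := emb q a ![] ∘ₗ coef q a ![])
      (g := LinearMap.id) fun w _ t => ?_) t
    rw [Subsingleton.elim w ![], LinearMap.comp_apply, coef_emb, coord_wedge_zero, one_smul]
    rfl

theorem emb₁_bijective : Function.Bijective (emb₁ q a) := by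
  refine ⟨Function.LeftInverse.injective
    (g := fun t => (coef q a ![0] t, coef q a ![1] t, coef q a ![2] t)) fun ⟨f, g, e⟩ => ?_,
    Function.RightInverse.surjective
    (g := fun t => (coef q a ![0] t, coef q a ![1] t, coef q a ![2] t)) fun t => ?_⟩
  · simp [emb₁, coef_emb, coord_wedge_one]
  · refine LinearMap.congr_fun (Term.hom_ext (f := emb q a ![0] ∘ₗ coef q a ![0] +
      emb q a ![1] ∘ₗ coef q a ![1] + emb q a ![2] ∘ₗ coef q a ![2])
      (g := LinearMap.id) fun w hw t => ?_) t
    obtain rfl | rfl | rfl := strictMono_fin_one w <;>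
      simp [coef_emb, coord_wedge_one]

theorem emb₂_bijective : Function.Bijective (emb₂ q a) := by
  refine ⟨Function.LeftInverse.injective
    (g := fun t => (coef q a ![1, 2] t, coef q a ![0, 2] t, coef q a ![0, 1] t))
      fun ⟨f, g, e⟩ => ?_,
    Function.RightInverse.surjective
    (g := fun t => (coef q a ![1, 2] t, coef q a ![0, 2] t, coef q a ![0, 1] t)) fun t => ?_⟩
  · simp [emb₂, coef_emb, coord_wedge_two]
  · refine LinearMap.congr_fun (Term.hom_ext (f := emb q a ![1, 2] ∘ₗ coef q a ![1, 2] +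
      emb q a ![0, 2] ∘ₗ coef q a ![0, 2] + emb q a ![0, 1] ∘ₗ coef q a ![0, 1])
      (g := LinearMap.id) fun w hw t => ?_) t
    obtain rfl | rfl | rfl := strictMono_fin_two w hw <;>
      simp [coef_emb, coord_wedge_two]

theorem emb_three_bijective : Function.Bijective (emb q a ![0, 1, 2]) := by
  refine ⟨Function.LeftInverse.injective (g := coef q a ![0, 1, 2]) fun t => ?_,
    Function.RightInverse.surjective (g := coef q a ![0, 1, 2]) fun t => ?_⟩
  · rw [coef_emb, coord_wedge_three, one_smul]
  · refine LinearMap.congr_fun (Term.hom_ext (f := emb q a ![0, 1, 2] ∘ₗ coef q a ![0, 1, 2])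
      (g := LinearMap.id) fun w hw t => ?_) t
    rw [strictMono_fin_three w hw, LinearMap.comp_apply, coef_emb, coord_wedge_three, one_smul]
    rfl

/-! ### The differentials in coordinates -/

variable {q a}

/-- The outer action on a fixed element `m`: the map `u ⊗ v ↦ umv`. -/
def act {j : ℕ} (m : Term q a j) : GWA q a ⊗[k] GWA q a →ₗ[k] Term q a j :=
  (LinearMap.toSpanSingleton (Env k (GWA q a)) (Term q a j) m).restrictScalars k ∘ₗ
    LinearMap.lTensor (GWA q a) (MulOpposite.opLinearEquiv k).toLinearMap

theorem act_apply {j : ℕ} (m : Term q a j) (t : GWA q a ⊗[k] GWA q a) :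
    act m t = (LinearMap.lTensor (GWA q a) (MulOpposite.opLinearEquiv k).toLinearMap t :
      Env k (GWA q a)) • m := rfl

theorem act_tmul {j : ℕ} (m : Term q a j) (u v : GWA q a) :
    act m (u ⊗ₜ v) = (u ⊗ₜ MulOpposite.op v : Env k (GWA q a)) • m := rfl

theorem act_add {j : ℕ} (m n : Term q a j) (t : GWA q a ⊗[k] GWA q a) :
    act (m + n) t = act m t + act n t := by
  simp only [act_apply, smul_add]

theorem act_sub {j : ℕ} (m n : Term q a j) (t : GWA q a ⊗[k] GWA q a) :
    act (m - n) t = act m t - act n t := by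
  simp only [act_apply, smul_sub]

theorem act_neg {j : ℕ} (m : Term q a j) (t : GWA q a ⊗[k] GWA q a) :
    act (-m) t = -act m t := by
  simp only [act_apply, smul_neg]

theorem act_smul {j : ℕ} (c : k) (m : Term q a j) (t : GWA q a ⊗[k] GWA q a) :
    act (c • m) t = c • act m t := by
  simp only [act_apply]
  exact smul_comm _ _ _

theorem act_sum {j : ℕ} {ι : Type*} (S : Finset ι) (m : ι → Term q a j)
    (t : GWA q a ⊗[k] GWA q a) : act (∑ i ∈ S, m i) t = ∑ i ∈ S, act (m i) t := by
  simp only [act_apply, Finset.smul_sum]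

/-- By `A^e`-linearity a generator with value `m` contributes `u ⊗ v ↦ umv`; together with `act_el`
this translates the defining formulas of the differentials into matrices. -/
theorem single_emb {i j : ℕ} (w w' : Fin i → Fin 3) (m : Term q a j)
    (t : GWA q a ⊗[k] GWA q a) :
    single q a w m (emb q a w' t) = coord w (wedge w' : ⋀[k]^i (V k)) • act m t := by
  induction t with
  | zero => simp only [map_zero, smul_zero]
  | add s t hs ht => simp only [map_add, smul_add, hs, ht]
  | tmul u v =>
    rw [emb_tmul, single, el, ofGen_tri, LinearMap.smulRight_apply, smul_comm, act_tmul]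

/-- Acting from outside on `r|w|s` multiplies from inside: `u(r|w|s)v = ur|w|sv`. This is why only
inner operators appear in coordinates. -/
theorem act_el {j : ℕ} (w : Fin j → Fin 3) (r s : GWA q a) (t : GWA q a ⊗[k] GWA q a) :
    act (el q a r w s) t
      = emb q a w (TensorProduct.map (LinearMap.mulRight k r) (LinearMap.mulLeft k s) t) := by
  induction t with
  | zero => simp only [map_zero]
  | add s t hs ht => simp only [map_add, hs, ht]
  | tmul u v => exact env_smul_tri _ _ _ _ _

theorem act_el_one {j : ℕ} (w : Fin j → Fin 3) (s : GWA q a) (t : GWA q a ⊗[k] GWA q a) :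
    act (el q a 1 w s) t = emb q a w (LinearMap.lTensor (GWA q a) (LinearMap.mulLeft k s) t) := by
  rw [act_el, LinearMap.mulRight_one]
  rfl

theorem act_el_gen_one {j : ℕ} (w : Fin j → Fin 3) (r : GWA q a) (t : GWA q a ⊗[k] GWA q a) :
    act (el q a r w 1) t = emb q a w (LinearMap.rTensor (GWA q a) (LinearMap.mulRight k r) t) := by
  rw [act_el, LinearMap.mulLeft_one]
  rfl

theorem map_pow_mul (r : GWA q a) (s t : ℕ) :
    TensorProduct.map (LinearMap.mulRight k (r ^ s)) (LinearMap.mulLeft k (r ^ t))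
      = LinearMap.rTensor (GWA q a) (LinearMap.mulRight k r) ^ s
        * LinearMap.lTensor (GWA q a) (LinearMap.mulLeft k r) ^ t := by
  rw [LinearMap.rTensor_pow, LinearMap.lTensor_pow, LinearMap.pow_mulLeft, LinearMap.pow_mulRight]
  exact (LinearMap.rTensor_comp_lTensor _ _ _).symm

/-- Weights `c^s e^t` in an integral rescale the two nodes of the divided difference. The hypothesis
on `β` is asked only for `s < i` with `t = i - 1 - s`, so that weights such as `q^(i-1) = q^s q^t`
are covered. -/
theorem act_sum_tint {j : ℕ} (w : Fin j → Fin 3) (c e : k) (t : GWA q a ⊗[k] GWA q a)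
    (β : ℕ → ℕ → ℕ → k)
    (hβ : ∀ i s, s < i → β i s (i - 1 - s) = a.coeff i * (c ^ s * e ^ (i - 1 - s))) :
    act (∑ i ∈ Finset.range (a.natDegree + 1), tint i fun s t =>
        β i s t • el q a (GWA.gen q a 1 ^ s) w (GWA.gen q a 1 ^ t)) t
      = emb q a w ((gwaOps q a).diff a c e t) := by
  rw [Ops.diff, divDiff, act_sum, LinearMap.sum_apply, map_sum]
  refine Finset.sum_congr rfl fun i _ => ?_
  rw [tint, act_sum, LinearMap.sum_apply, map_sum]
  refine Finset.sum_congr rfl fun s hs => ?_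
  rw [hβ i s (Finset.mem_range.1 hs), act_smul, act_el, map_pow_mul, ← map_smul]
  congr 1
  simp only [gwaOps, tensorOps, smul_pow, smul_mul_smul_comm, LinearMap.smul_apply, smul_smul]

theorem smithPoly_coeff (i : ℕ) : (smithPoly q a).coeff i = (q ^ i - 1) * a.coeff i := by
  rw [smithPoly, Polynomial.coeff_sub, Polynomial.comp_C_mul_X_coeff]
  ring

theorem mulMap_emb (t : GWA q a ⊗[k] GWA q a) :
    mulMap q a (emb q a ![] t) = LinearMap.mul' k (GWA q a) t := by
  induction t with
  | zero => simp only [map_zero]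
  | add s t hs ht => simp only [map_add, hs, ht]
  | tmul u v =>
    rw [emb_tmul, el, mulMap, ofGen_tri, LinearMap.smulRight_apply, coord_wedge_zero, one_smul]
    change u • MulOpposite.op v • (1 : GWA q a) = u * v
    simp

end Coordinates

/-! ### Identification of `d` and `δ` with the matrices of inner operators -/

section Differentials

variable {k : Type u} [Field k] {q : k} {a : k[X]}

theorem emb₁_add (v w) : emb₁ q a (v + w) = emb₁ q a v + emb₁ q a w := by
  simp only [emb₁, Prod.fst_add, Prod.snd_add, map_add]
  abel

theorem emb₂_add (v w) : emb₂ q a (v + w) = emb₂ q a v + emb₂ q a w := by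
  simp only [emb₂, Prod.fst_add, Prod.snd_add, map_add]
  abel

theorem dHor_emb₁ (v) : dHor q a 0 (emb₁ q a v) = emb q a ![] ((gwaOps q a).d₁ v) := by
  obtain ⟨f, g, e⟩ := v
  simp only [dHor, emb₁, map_add, LinearMap.add_apply, single_emb, coord_wedge_one, act_sub,
    act_el_one, act_el_gen_one, Ops.d₁_apply]
  simp [gwaOps, tensorOps]
  abel

theorem dHor_emb₂ (v) : dHor q a 1 (emb₂ q a v) = emb₁ q a ((gwaOps q a).d₂ q a v) := by
  obtain ⟨f, g, e⟩ := v
  have hl : act (∑ i ∈ Finset.range (a.natDegree + 1), tint i fun s t =>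
      (smithPoly q a).coeff i • el q a (GWA.gen q a 1 ^ s) ![1] (GWA.gen q a 1 ^ t)) g
      = emb q a ![1] (q • (gwaOps q a).diff a q q g - (gwaOps q a).diff a 1 1 g) := by
    rw [map_sub, map_smul,
      ← act_sum_tint (a := a) ![1] q q g (fun i s t => a.coeff i * (q ^ s * q ^ t))
      (fun _ _ _ => rfl),
      ← act_sum_tint (a := a) ![1] 1 1 g (fun i s t => a.coeff i * (1 ^ s * 1 ^ t))
      (fun _ _ _ => rfl), ← act_smul, ← act_sub, Finset.smul_sum, ← Finset.sum_sub_distrib]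
    congr 2
    refine Finset.sum_congr rfl fun i _ => ?_
    simp only [tint]
    rw [Finset.smul_sum, ← Finset.sum_sub_distrib]
    refine Finset.sum_congr rfl fun s hs => ?_
    have hs := Finset.mem_range.1 hs
    rw [smul_smul, ← sub_smul, smithPoly_coeff]
    congr 1
    -- Since `s + t + 1 = i`, the part `q^i α_i` of `λ_i` is `q` times the weight `q^s q^t`, whence
    -- the coefficient `q` before `diff a q q`.
    have : q ^ i = q * (q ^ s * q ^ (i - 1 - s)) := by
      rw [← pow_add, ← pow_succ']
      congr 1
      omega
    rw [this]
    ring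
  simp only [dHor, emb₂, map_add, LinearMap.add_apply, single_emb, coord_wedge_two, act_sub,
    act_add, act_smul, act_el_one, act_el_gen_one, Ops.d₂_apply, hl]
  simp [emb₁, gwaOps, tensorOps, smul_sub]
  abel

theorem dHor_emb₃ (t) :
    dHor q a 2 (emb q a ![0, 1, 2] t) = emb₂ q a ((gwaOps q a).d₃ q t) := by
  have h3 : coord (j := 2 + 1) ![0, 1, 2] (wedge ![0, 1, 2] : ⋀[k]^(2 + 1) (V k)) = 1 :=
    coord_wedge_three
  simp only [dHor, single_emb, h3, act_sub, act_add, act_smul, act_el_one,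
    act_el_gen_one, Ops.d₃_apply]
  simp [emb₂, gwaOps, tensorOps, smul_sub]
  abel

theorem dVert_emb₀ (t) : dVert q a 0 (emb q a ![] t) = emb₁ q a ((gwaOps q a).δ₀ a t) := by
  simp only [dVert, single_emb, coord_wedge_zero, act_sub, act_add, act_el_one,
    act_el_gen_one, Ops.δ₀_apply, act_sum_tint ![1] 1 1 t (fun i _ _ => a.coeff i) (by simp)]
  simp [emb₁, gwaOps, tensorOps]
  abel

theorem dVert_emb₁ (v) : dVert q a 1 (emb₁ q a v) = emb₂ q a ((gwaOps q a).δ₁ q a v) := by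
  obtain ⟨f, g, e⟩ := v
  simp only [dVert, emb₁, map_add, LinearMap.add_apply, single_emb, coord_wedge_one, act_sub,
    act_add, act_neg, act_el_one, act_el_gen_one, Ops.δ₁_apply,
    act_sum_tint (a := a) ![0, 1] 1 q _ (fun i _ t => a.coeff i * q ^ t) (by simp),
    act_sum_tint (a := a) ![1, 2] q 1 _ (fun i s _ => a.coeff i * q ^ s) (by simp)]
  simp [emb₂, gwaOps, tensorOps]
  abel

theorem dVert_emb₂ (v) :
    dVert q a 2 (emb₂ q a v) = emb q a ![0, 1, 2] ((gwaOps q a).δ₂ q a v) := by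
  obtain ⟨f, g, e⟩ := v
  have hβ : ∀ i s, s < i →
      a.coeff i * q ^ (i - 1) = a.coeff i * (q ^ s * q ^ (i - 1 - s)) := fun i s hs => by
    rw [← pow_add, Nat.add_sub_cancel' (by omega)]
  simp only [dVert, emb₂, map_add, LinearMap.add_apply, single_emb, coord_wedge_two, act_el_one,
    act_el_gen_one, Ops.δ₂_apply,
    act_sum_tint (a := a) ![0, 1, 2] q q _ (fun i _ _ => a.coeff i * q ^ (i - 1)) hβ]
  simp [gwaOps, tensorOps]
  abel

end Differentials

section DoubleComplex

variable {k : Type u} [Field k] (q : k) (a : k[X])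

/-! ### The identities of the double complex -/

theorem dHor_comp_dHor (j : ℕ) : dHor q a j ∘ₗ dHor q a (j + 1) = 0 := by
  match j with
  | 0 =>
    refine LinearMap.ext fun t => ?_
    obtain ⟨v, rfl⟩ := (emb₂_bijective q a).2 t
    change dHor q a 0 (dHor q a 1 _) = 0
    rw [dHor_emb₂, dHor_emb₁, (gwaOps_isSmith q a).d₁_d₂, map_zero]
  | 1 =>
    refine LinearMap.ext fun t => ?_
    obtain ⟨v, rfl⟩ := (emb_three_bijective q a).2 t
    change dHor q a 1 (dHor q a 2 _) = 0
    rw [dHor_emb₃, dHor_emb₂, (gwaOps_isSmith q a).d₂_d₃]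
    simp [emb₁]
  | _ + 2 => exact LinearMap.comp_zero _

theorem dVert_comp_dVert (j : ℕ) : dVert q a (j + 1) ∘ₗ dVert q a j = 0 := by
  match j with
  | 0 =>
    refine LinearMap.ext fun t => ?_
    obtain ⟨v, rfl⟩ := (emb_zero_bijective q a).2 t
    change dVert q a 1 (dVert q a 0 _) = 0
    rw [dVert_emb₀, dVert_emb₁, (gwaOps_isSmith q a).δ₁_δ₀]
    simp [emb₂]
  | 1 =>
    refine LinearMap.ext fun t => ?_
    obtain ⟨v, rfl⟩ := (emb₁_bijective q a).2 t
    change dVert q a 2 (dVert q a 1 _) = 0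
    rw [dVert_emb₁, dVert_emb₂, (gwaOps_isSmith q a).δ₂_δ₁, map_zero]
  | _ + 2 => exact LinearMap.zero_comp _

theorem dHor_comp_dVert_zero : dHor q a 0 ∘ₗ dVert q a 0 = 0 := by
  refine LinearMap.ext fun t => ?_
  obtain ⟨v, rfl⟩ := (emb_zero_bijective q a).2 t
  change dHor q a 0 (dVert q a 0 _) = 0
  rw [dVert_emb₀, dHor_emb₁, (gwaOps_isSmith q a).d₁_δ₀, gwaOps_casimir]
  simp

theorem dHor_comp_dVert_add (j : ℕ) :
    dHor q a (j + 1) ∘ₗ dVert q a (j + 1) + dVert q a j ∘ₗ dHor q a j = 0 := by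
  match j with
  | 0 =>
    refine LinearMap.ext fun t => ?_
    obtain ⟨v, rfl⟩ := (emb₁_bijective q a).2 t
    change dHor q a 1 (dVert q a 1 _) + dVert q a 0 (dHor q a 0 _) = 0
    rw [dVert_emb₁, dHor_emb₂, dHor_emb₁, dVert_emb₀, ← emb₁_add,
      (gwaOps_isSmith q a).d₂_δ₁ (gwaOps_casimir q a)]
    simp [emb₁]
  | 1 =>
    refine LinearMap.ext fun t => ?_
    obtain ⟨v, rfl⟩ := (emb₂_bijective q a).2 t
    change dHor q a 2 (dVert q a 2 _) + dVert q a 1 (dHor q a 1 _) = 0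
    rw [dVert_emb₂, dHor_emb₃, dHor_emb₂, dVert_emb₁, ← emb₂_add,
      (gwaOps_isSmith q a).d₃_δ₂ (gwaOps_casimir q a)]
    simp [emb₂]
  | 2 =>
    refine LinearMap.ext fun t => ?_
    obtain ⟨v, rfl⟩ := (emb_three_bijective q a).2 t
    -- The maps to and from exterior degree 4 are zero, so only `δd` remains on `Y ∧ H ∧ X`.
    change (0 : Term q a 3) + dVert q a 2 (dHor q a 2 _) = 0
    rw [dHor_emb₃, dVert_emb₂, (gwaOps_isSmith q a).δ₂_d₃ (gwaOps_casimir q a), map_zero, add_zero]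
  | _ + 3 => exact (congrArg₂ _ (LinearMap.zero_comp _) (LinearMap.zero_comp _)).trans (add_zero _)

/-! ### Homology of the rows -/

variable {q}

theorem eq_zero_of_dHor_two (hq : q ≠ 0) (t : Term q a 3) (ht : dHor q a 2 t = 0) : t = 0 := by
  obtain ⟨e, rfl⟩ := (emb_three_bijective q a).2 t
  rw [dHor_emb₃] at ht
  have h0 : emb₂ q a 0 = 0 := by simp [emb₂]
  rw [(gwaOps_rowHomology a hq).eq_zero e ((emb₂_bijective q a).1 (ht.trans h0.symm)), map_zero]

theorem exists_dHor_two (hq : q ≠ 0) (t : Term q a 2) (ht : dHor q a 1 t = 0) :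
    ∃ s, dHor q a 2 s = t := by
  obtain ⟨v, rfl⟩ := (emb₂_bijective q a).2 t
  rw [dHor_emb₂] at ht
  have h0 : emb₁ q a 0 = 0 := by simp [emb₁]
  obtain ⟨e, he⟩ := (gwaOps_rowHomology a hq).exists_d₃ v ((emb₁_bijective q a).1 (ht.trans h0.symm))
  exact ⟨emb q a ![0, 1, 2] e, by rw [dHor_emb₃, he]⟩

theorem exists_dHor_one_add_dVert_zero (hq : q ≠ 0) (t : Term q a 1) (ht : dHor q a 0 t = 0) :
    ∃ w e, dHor q a 1 w + dVert q a 0 e = t := by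
  obtain ⟨v, rfl⟩ := (emb₁_bijective q a).2 t
  rw [dHor_emb₁] at ht
  obtain ⟨w, e, h⟩ := (gwaOps_rowHomology a hq).exists_d₂_add_δ₀ v
    ((emb_zero_bijective q a).1 (ht.trans (map_zero _).symm))
  exact ⟨emb₂ q a w, emb q a ![] e, by rw [dHor_emb₂, dVert_emb₀, ← emb₁_add, h]⟩

theorem exists_dHor_zero (hq : q ≠ 0) (e : Term q a 0) (w : Term q a 2)
    (h : dVert q a 0 e = dHor q a 1 w) : ∃ v, dHor q a 0 v = e := by
  obtain ⟨e, rfl⟩ := (emb_zero_bijective q a).2 e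
  obtain ⟨w, rfl⟩ := (emb₂_bijective q a).2 w
  rw [dHor_emb₂, dVert_emb₀] at h
  obtain ⟨v, hv⟩ := (gwaOps_rowHomology a hq).exists_d₁ e w ((emb₁_bijective q a).1 h)
  exact ⟨emb₁ q a v, by rw [dHor_emb₁, hv]⟩

theorem mulMap_eq_zero_iff (hq : q ≠ 0) (e : Term q a 0) :
    mulMap q a e = 0 ↔ ∃ v, dHor q a 0 v = e := by
  constructor
  · intro h
    obtain ⟨e, rfl⟩ := (emb_zero_bijective q a).2 e
    rw [mulMap_emb] at h
    obtain ⟨v, hv⟩ := exists_d₁_of_mul'_eq_zero a hq e h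
    exact ⟨emb₁ q a v, by rw [dHor_emb₁, hv]⟩
  · rintro ⟨v, rfl⟩
    obtain ⟨v, rfl⟩ := (emb₁_bijective q a).2 v
    rw [dHor_emb₁, mulMap_emb, mul'_d₁]

theorem mulMap_surjective (q : k) : Function.Surjective (mulMap q a) := fun b =>
  ⟨emb q a ![] (1 ⊗ₜ b), by rw [mulMap_emb, LinearMap.mul'_apply, one_mul]⟩

/-! ### The total complex -/

variable (q)

/-- `A|W|A` is the base change to `A^e` of a vector space. -/
theorem free_term (j : ℕ) : Module.Free (Env k (GWA q a)) (Term q a j) :=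
  Module.Free.of_equiv
    { triEquiv k (GWA q a) (⋀[k]^j (V k)) with map_smul' := triEquiv_smul :
      Term q a j ≃ₗ[Env k (GWA q a)] Env k (GWA q a) ⊗[k] ⋀[k]^j (V k) }.symm

instance (n : ℕ) : Finite (TotIndex n) :=
  Set.Finite.to_subtype (s := {jq : ℕ × ℕ | jq.1 + 2 * jq.2 = n}) <|
    ((Set.finite_Iic n).prod (Set.finite_Iic n)).subset fun jq (h : _ = n) =>
      ⟨Set.mem_Iic.2 (by omega), Set.mem_Iic.2 (by omega)⟩

theorem free_tot (n : ℕ) : Module.Free (Env k (GWA q a)) (Tot q a n) :=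
  haveI := free_term q a
  Module.Free.pi _ _

variable {a} in
theorem totD_zero_apply {n : ℕ} (z : Tot q a (n + 1)) (r : ℕ) (hr : 0 + 2 * r = n) :
    totD q a n z ⟨(0, r), hr⟩ = dHor q a 0 (z ⟨(1, r), by omega⟩) := rfl

variable {a} in
theorem totD_succ_apply {n : ℕ} (z : Tot q a (n + 1)) (j r : ℕ) (hr : j + 1 + 2 * r = n) :
    totD q a n z ⟨(j + 1, r), hr⟩
      = dHor q a (j + 1) (z ⟨(j + 2, r), by omega⟩) + dVert q a j (z ⟨(j, r + 1), by omega⟩) := rfl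

theorem totD_totD (n : ℕ) (z : Tot q a (n + 2)) : totD q a n (totD q a (n + 1) z) = 0 := by
  funext ⟨⟨j, r⟩, hr⟩
  match j, hr with
  | 0, hr =>
    rw [totD_zero_apply, totD_succ_apply, map_add]
    have h1 := LinearMap.congr_fun (dHor_comp_dHor q a 0) (z ⟨(2, r), by omega⟩)
    have h2 := LinearMap.congr_fun (dHor_comp_dVert_zero q a) (z ⟨(0, r + 1), by omega⟩)
    exact (congrArg₂ _ h1 h2).trans (add_zero _)
  | 1, hr =>
    rw [totD_succ_apply, totD_succ_apply, totD_zero_apply, map_add, add_assoc]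
    have h1 := LinearMap.congr_fun (dHor_comp_dHor q a 1) (z ⟨(3, r), by omega⟩)
    have h2 := LinearMap.congr_fun (dHor_comp_dVert_add q a 0) (z ⟨(1, r + 1), by omega⟩)
    exact (congrArg₂ _ h1 h2).trans (add_zero _)
  | j + 2, hr =>
    rw [totD_succ_apply, totD_succ_apply, totD_succ_apply, map_add, map_add]
    have h1 := LinearMap.congr_fun (dHor_comp_dHor q a (j + 2)) (z ⟨(j + 4, r), by omega⟩)
    have h2 := LinearMap.congr_fun (dHor_comp_dVert_add q a (j + 1)) (z ⟨(j + 2, r + 1), by omega⟩)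
    have h3 := LinearMap.congr_fun (dVert_comp_dVert q a j) (z ⟨(j, r + 2), by omega⟩)
    -- The four terms group as `d² + (dδ + δd) + δ²`; the rest is reassociation.
    have h4 := congrArg₂ (· + ·) (congrArg₂ (· + ·) h1 h2) h3
    simp only [LinearMap.zero_apply, add_zero] at h4
    refine Eq.trans ?_ h4
    exact (add_assoc _ _ _).trans ((congrArg _ (add_assoc _ _ _).symm).trans (add_assoc _ _ _).symm)

variable {q}

/-- In a fixed total degree the exterior degrees all have the same parity and the terms with `j ≥ 4`
vanish, so a cycle has at most two components: `j = 1, 3` or `j = 0, 2`. The first is solved by the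
homology of the rows, and the second is corrected by the anticommutation of `d` and `δ`. -/
theorem exists_totD (hq : q ≠ 0) (n : ℕ) (z : Tot q a (n + 1)) (hz : totD q a n z = 0) :
    ∃ w, totD q a (n + 1) w = z := by
  obtain ⟨m, rfl | rfl⟩ := n.even_or_odd'
  · have h0 := congrFun hz ⟨(0, m), by omega⟩
    rw [totD_zero_apply] at h0
    obtain ⟨w₂, w₀, h1⟩ := exists_dHor_one_add_dVert_zero a hq _ h0
    -- In a given total degree `j` determines the row, so a family indexed by `j` alone defines an
    -- element of the total complex.
    let F : ∀ j, Term q a j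
      | 0 => w₀
      | 2 => w₂
      | _ => 0
    refine ⟨fun i => F i.1.1, ?_⟩
    funext ⟨⟨j, r⟩, hr⟩
    match j, hr with
    | 0, hr => omega
    | 1, hr =>
      obtain rfl : r = m := by omega
      rw [totD_succ_apply]
      exact h1
    | 2, hr => omega
    | 3, hr =>
      obtain rfl : m = r + 1 := by omega
      rw [totD_succ_apply]
      change dHor q a 3 0 + dVert q a 2 w₂ = _
      rw [map_zero, zero_add, ← sub_eq_zero]
      -- No freedom is left for the `j = 3` component: it must already equal `δw₂`. Both have the
      -- same image under `d`, which is injective there.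
      apply eq_zero_of_dHor_two a hq
      have h2 := congrFun hz ⟨(2, r), by omega⟩
      rw [totD_succ_apply, ← h1, map_add] at h2
      have h3 := LinearMap.congr_fun (dHor_comp_dVert_add q a 1) w₂
      have h4 := LinearMap.congr_fun (dVert_comp_dVert q a 0) w₀
      change dHor q a 2 (dVert q a 2 w₂) + dVert q a 1 (dHor q a 1 w₂) = 0 at h3
      change dVert q a 1 (dVert q a 0 w₀) = 0 at h4
      rw [h4, add_zero] at h2
      rw [map_sub, sub_eq_zero]
      exact add_right_cancel (h3.trans h2.symm)
    | j + 4, hr =>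
      have : Subsingleton (Term q a (j + 4)) := Term.subsingleton (by omega)
      exact Subsingleton.elim _ _
  · have h0 := congrFun hz ⟨(1, m), by omega⟩
    rw [totD_succ_apply] at h0
    change dHor q a 1 _ + dVert q a 0 _ = 0 at h0
    -- The cycle equation says that `δ` of the `j = 0` component is a horizontal boundary. As `δ` is
    -- injective from degree 0 to degree 1 homology of rows, that component is itself a boundary.
    obtain ⟨w₁, h1⟩ := exists_dHor_zero a hq _ (-z ⟨(2, m), by omega⟩)
      ((eq_neg_of_add_eq_zero_right h0).trans (map_neg _ _).symm)
    obtain ⟨w₃, h2⟩ := exists_dHor_two a hq (z ⟨(2, m), by omega⟩ - dVert q a 1 w₁) (by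
      have h3 := LinearMap.congr_fun (dHor_comp_dVert_add q a 0) w₁
      change dHor q a 1 (dVert q a 1 w₁) + dVert q a 0 (dHor q a 0 w₁) = 0 at h3
      rw [h1] at h3
      rw [map_sub, sub_eq_zero]
      exact add_right_cancel (h0.trans h3.symm))
    let F : ∀ j, Term q a j
      | 1 => w₁
      | 3 => w₃
      | _ => 0
    refine ⟨fun i => F i.1.1, ?_⟩
    funext ⟨⟨j, r⟩, hr⟩
    match j, hr with
    | 0, hr =>
      obtain rfl : r = m + 1 := by omega
      exact h1
    | 1, hr => omega
    | 2, hr =>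
      obtain rfl : r = m := by omega
      rw [totD_succ_apply]
      change dHor q a 2 w₃ + dVert q a 1 w₁ = _
      rw [h2, sub_add_cancel]
    | 3, hr => omega
    | j + 4, hr =>
      have : Subsingleton (Term q a (j + 4)) := Term.subsingleton (by omega)
      exact Subsingleton.elim _ _

theorem exact_totD (hq : q ≠ 0) (n : ℕ) : Function.Exact (totD q a (n + 1)) (totD q a n) :=
  fun z => ⟨exists_totD a hq n z, by rintro ⟨w, rfl⟩; exact totD_totD q a n w⟩

theorem exact_aug (hq : q ≠ 0) : Function.Exact (totD q a 0) (aug q a) := by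
  intro z
  refine (mulMap_eq_zero_iff a hq _).trans ⟨?_, ?_⟩
  · rintro ⟨v, hv⟩
    let F : ∀ j, Term q a j
      | 1 => v
      | _ => 0
    refine ⟨fun i => F i.1.1, ?_⟩
    funext ⟨⟨j, r⟩, hr⟩
    obtain ⟨rfl, rfl⟩ : j = 0 ∧ r = 0 := by omega
    exact hv
  · rintro ⟨w, rfl⟩
    exact ⟨_, rfl⟩

theorem aug_surjective (q : k) : Function.Surjective (aug q a) := fun b => by
  obtain ⟨t, rfl⟩ := mulMap_surjective a q b
  let F : ∀ j, Term q a j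
    | 0 => t
    | _ => 0
  exact ⟨fun i => F i.1.1, rfl⟩

end DoubleComplex

end QuantumGWA

end

/-! ### The quotient presentation, the double complex and the free resolution together -/

theorem mainTheorem5 {k : Type*} [Field k] [CharZero k] (q : k) (hq0 : q ≠ 0) (hq1 : q ≠ 1)
    (a : Polynomial k) (ha : a.Monic) (hdeg : 1 < a.natDegree) :
    -- `Ω` is central in `B`, and `A` is the quotient of `B` by the ideal `BΩ`
    (QuantumGWA.Omega q a ∈ Subalgebra.center k (QuantumGWA.Smith q (QuantumGWA.smithPoly q a)) ∧
      ∃ π : QuantumGWA.Smith q (QuantumGWA.smithPoly q a) →ₐ[k] QuantumGWA.GWA q a,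
        (∀ i, π (QuantumGWA.Smith.gen q (QuantumGWA.smithPoly q a) i) = QuantumGWA.GWA.gen q a i) ∧
        Function.Surjective π ∧
        ∀ b, π b = 0 ↔ ∃ c, b = c * QuantumGWA.Omega q a) ∧
    -- the horizontal and vertical maps form a double complex with anti-commuting differentials
    ((∀ j, QuantumGWA.dHor q a j ∘ₗ QuantumGWA.dHor q a (j + 1) = 0) ∧
      (∀ j, QuantumGWA.dVert q a (j + 1) ∘ₗ QuantumGWA.dVert q a j = 0) ∧
      QuantumGWA.dHor q a 0 ∘ₗ QuantumGWA.dVert q a 0 = 0 ∧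
      ∀ j, QuantumGWA.dHor q a (j + 1) ∘ₗ QuantumGWA.dVert q a (j + 1)
        + QuantumGWA.dVert q a j ∘ₗ QuantumGWA.dHor q a j = 0) ∧
    -- the total complex, augmented by multiplication, is a free resolution of `A` over `A^e`
    (∀ n, Module.Free (QuantumGWA.Env k (QuantumGWA.GWA q a)) (QuantumGWA.Tot q a n)) ∧
    Function.Surjective (QuantumGWA.aug q a) ∧
    Function.Exact (QuantumGWA.totD q a 0) (QuantumGWA.aug q a) ∧
    ∀ n, Function.Exact (QuantumGWA.totD q a (n + 1)) (QuantumGWA.totD q a n) :=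
  ⟨⟨QuantumGWA.omega_mem_center q a, QuantumGWA.smithToGWA q a, QuantumGWA.smithToGWA_gen q a,
      QuantumGWA.smithToGWA_surjective q a, QuantumGWA.smithToGWA_eq_zero_iff q a⟩,
    ⟨QuantumGWA.dHor_comp_dHor q a, QuantumGWA.dVert_comp_dVert q a,
      QuantumGWA.dHor_comp_dVert_zero q a, QuantumGWA.dHor_comp_dVert_add q a⟩,
    QuantumGWA.free_tot q a, QuantumGWA.aug_surjective a q, QuantumGWA.exact_aug a hq0,
    QuantumGWA.exact_totD a hq0⟩
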